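/- Let $n\ge 1$ and let $D$ be the set of Dyck words over $\{1,0\}$ (equally many $1$s and $0$s, and every prefix has at least as many $1$s as $0$s), with $D_n\subseteq D$ the words of length $2n$. Every nonempty $x\in D$ is uniquely $x=1u0v$ with $u,v\in D$. Words in $D_n$ are identified with ordered rooted trees with $n$ edges: in $x=1u0v$ the subtree hanging on the leftmost child of the root is $u$, and the remaining tree at the root is $v$. The rotation $\mathrm{rot}(1u0v)=u1v0$ shifts the root to its leftmost child; plane trees with $n$ edges are the equivalence classes of $D_n$ under rotation. A leaf is a vertex of degree $1$ (the root may be a leaf); it is thin if its neighbor has degree $2$. A star is a tree in which all but at most one vertex are leaves. The center of a tree is the set of vertices minimizing the maximum distance to any other vertex; it consists of one vertex or of two adjacent vertices. The canonical rooting $\hat x$ of $x\in D_n$ is the following rotation of $x$. If there are two centers, take the lexicographically smaller of the two rotations of $x$ whose root is one center and whose leftmost child of the root is the other. If the center is unique, take the rotation rooted at the center, with subtrees $y_1,\dots,y_k$ hanging on the children of the root in this order, for which the string $(-1,y_1,-1,y_2,\dots,-1,y_k)$ is lexicographically smallest. For words $x=110w0v\in D_n$ with $w,v\in D$ let $\tau(x)=101w0v$.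 For such $x$, $\mathrm{IsFlipTree}(x)$ is defined as follows. It is false if $x$ is a star. If $x$ is not a star and has a thin leaf, it is true iff $x$ is the first tree of the form $1100v$ ($v\in D$) in the sequence $\hat x,\mathrm{rot}(\hat x),\mathrm{rot}^2(\hat x),\dots$. If $x$ is not a star and has no thin leaf, it is true iff $x$ is the first tree of the form $1(10)^k0v$ ($k\ge 2$, $v\in D$) in this sequence and, in addition, $v=(10)^l$ implies $l\ge k$. Let $\mathcal T_n$ be the directed graph whose nodes are the plane trees with $n$ edges, with one directed edge from the class of $x$ to the class of $\tau(x)$ for every $x\in D_n$ of the form $110w0v$ for which $\mathrm{IsFlipTree}(x)$ is true. Then $\mathcal T_n$ is a spanning tree on its nodes: disregarding orientations, it is connected and acyclic (in particular it has no loops and no two edges joining the same two nodes). Moreover, every node of $\mathcal T_n$ has out-degree at most $1$. Define the signature of a tree as the triple (number of leaves, number of non-terminal leaves, maximum degree), where a leaf is terminal if it is adjacent to a leaf of the skeleton, i.e. of the tree obtained by deleting all leaves. Along every directed edge of $\mathcal T_n$ the signature strictly increases in the lexicographic order. Finally, the stars with $n$ edges form exactly one node; a node has an outgoing edge if and only if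 it is not the star; and from every node there is a directed path to the star. -/

import Mathlib

/-! Rooted ordered trees are encoded by Dyck words: `U` is the bit `1`, `D` is the bit `0`, and the
word `1 u 0 v` (in Mathlib: `u.nest + v`) is the tree in which the subtree hanging on the leftmost
child of the root is `u`, and in which deleting that child with its subtree leaves the tree `v`.
The number of edges is the semilength. -/

namespace FlipTree

section Graph

variable {V : Type*} (G : SimpleGraph V)

/-- The degree of a vertex (all graphs below are finite). -/
noncomputable def deg (v : V) : ℕ := (G.neighborSet v).ncard

/-- A leaf is a vertex of degree `1`. -/
def IsLeaf (v : V) : Prop := deg G v = 1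

/-- A leaf is thin if its (unique) neighbor has degree `2`. -/
def IsThinLeaf (v : V) : Prop := IsLeaf G v ∧ ∃ w, G.Adj v w ∧ deg G w = 2

/-- A star: all but at most one vertex are leaves. -/
def IsStar : Prop := {v | ¬ IsLeaf G v}.Subsingleton

/-- The skeleton: the graph obtained by removing all leaves. -/
def skeleton : SimpleGraph {v // ¬ IsLeaf G v} := G.induce {v | ¬ IsLeaf G v}

/-- A leaf is terminal if it is adjacent to a leaf of the skeleton. -/
def IsTerminalLeaf (v : V) : Prop :=
  IsLeaf G v ∧ ∃ w : {v // ¬ IsLeaf G v}, G.Adj v w.1 ∧ IsLeaf (skeleton G) w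

/-- The signature (number of leaves, number of non-terminal leaves, maximum degree), as an element
of `ℕ³` with the lexicographic order. -/
noncomputable def graphSignature : ℕ ×ₗ ℕ ×ₗ ℕ :=
  toLex ({v | IsLeaf G v}.ncard,
    toLex ({v | IsLeaf G v ∧ ¬ IsTerminalLeaf G v}.ncard, ⨆ v, deg G v))

end Graph

/-- The vertices of a rooted ordered tree, by recursion on the decomposition `1 u 0 v`
(Mathlib's `DyckWord.toTree` iterates this decomposition): the vertices of `u` and those of `v`. -/
def Vert : BinaryTree Unit → Type
  | .nil => Unit
  | .node _ u v => Vert u ⊕ Vert v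

/-- The root of `1 u 0 v` is the root of `v`. -/
def root : (t : BinaryTree Unit) → Vert t
  | .nil => ()
  | .node _ _ v => .inr (root v)

/-- The leftmost child of the root of `1 u 0 v` is the root of `u`.
(For the tree without edges the value is the root.) -/
def leftmostChild : (t : BinaryTree Unit) → Vert t
  | .nil => ()
  | .node _ u _ => .inl (root u)

/-- The underlying abstract tree: for `1 u 0 v`, the trees of `u` and `v` together with an edge
between their roots. -/
def treeGraph : (t : BinaryTree Unit) → SimpleGraph (Vert t)
  | .nil => ⊥
  | .node _ u v => (treeGraph u ⊕g treeGraph v) ⊔ SimpleGraph.edge (.inl (root u)) (.inr (root v))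

instance finiteVert : (t : BinaryTree Unit) → Finite (Vert t)
  | .nil => inferInstanceAs (Finite Unit)
  | .node _ u v =>
    have := finiteVert u
    have := finiteVert v
    inferInstanceAs (Finite (Vert u ⊕ Vert v))

/-- The underlying abstract tree of the rooted tree encoded by a Dyck word. -/
def graph (x : DyckWord) : SimpleGraph (Vert x.toTree) := treeGraph x.toTree

noncomputable def signature (x : DyckWord) : ℕ ×ₗ ℕ ×ₗ ℕ := graphSignature (graph x)

/-- Tree rotation `1 u 0 v ↦ u 1 v 0`; it shifts the root to its leftmost child. -/
def rot (x : DyckWord) : DyckWord :=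
  open Classical in if x = 0 then 0 else x.insidePart + x.outsidePart.nest

/-- The set of all rotations of `x`. -/
def rotations (x : DyckWord) : Set DyckWord := {z | ∃ r : ℕ, z = rot^[r] x}

/-- The bitstring of a Dyck word. -/
def bits (x : DyckWord) : List ℤ := x.toList.map fun s => if s = DyckStep.U then 1 else 0

/-- The string `(-1, y₁, -1, y₂, …, -1, yₖ)`, where `y₁, …, yₖ` are the bitstrings of the subtrees
hanging on the children of the root. -/
def subtreeString (x : DyckWord) : List ℤ :=
  go x.toTree
where
  go : BinaryTree Unit → List ℤ
    | .nil => []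
    | .node _ u v => -1 :: (bits (DyckWord.ofTree u) ++ go v)

/-- The tree has two center vertices. -/
def HasTwoCenters (x : DyckWord) : Prop := (graph x).center.ncard = 2

/-- `x` is rooted at a center vertex and, if there are two center vertices, its leftmost child is
the other one. -/
def CenterRooted (x : DyckWord) : Prop :=
  root x.toTree ∈ (graph x).center ∧
    (HasTwoCenters x → leftmostChild x.toTree ∈ (graph x).center)

/-- The string by which the center-rooted versions of a tree are compared. -/
noncomputable def rootingKey (x : DyckWord) : List ℤ :=
  open Classical in if HasTwoCenters x then bits x else subtreeString x

/-- `z` is the canonically rooted version of `x`: the rotation of `x`, among those that are rooted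
at a center (with the other center, if there are two, as leftmost child), whose string is
lexicographically smallest. -/
def IsCanonicalRooting (x z : DyckWord) : Prop :=
  (z ∈ rotations x ∧ CenterRooted z) ∧
    ∀ z' ∈ rotations x, CenterRooted z' → rootingKey z ≤ rootingKey z'

/-- The canonically rooted version of `x`. -/
noncomputable def canonicalRoot (x : DyckWord) : DyckWord :=
  Classical.epsilon (IsCanonicalRooting x)

/-- `z'` is obtained from `z` by rotating until the property `P` holds. -/
def RotatedUntil (P : DyckWord → Prop) (z z' : DyckWord) : Prop :=
  ∃ r : ℕ, z' = rot^[r] z ∧ P (rot^[r] z) ∧ ∀ s < r, ¬ P (rot^[s] z)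

/-- The word `(10)^k`. -/
def zigzag (k : ℕ) : DyckWord := k • DyckWord.nest 0

/-- `x = 1100v`. -/
def HasThinForm (x : DyckWord) : Prop := ∃ v : DyckWord, x = (zigzag 1).nest + v

/-- `x = 1(10)^k0v` with `k ≥ 2`. -/
def HasBushForm (x : DyckWord) : Prop :=
  ∃ (k : ℕ) (v : DyckWord), 2 ≤ k ∧ x = (zigzag k).nest + v

/-- `(x, y)` is a flippable pair: `x = 110w0v` and `y = τ(x) = 101w0v`. -/
def FlippablePair (x y : DyckWord) : Prop :=
  ∃ w v : DyckWord, x = (DyckWord.nest 0 + w).nest + v ∧ y = DyckWord.nest 0 + w.nest + v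

/-- The Boolean function `IsFlipTree`, for trees `x` of the form `110w0v`. -/
def IsFlipTree (x : DyckWord) : Prop :=
  ¬ IsStar (graph x) ∧
    (((∃ a, IsThinLeaf (graph x) a) ∧ RotatedUntil HasThinForm (canonicalRoot x) x) ∨
     ((¬ ∃ a, IsThinLeaf (graph x) a) ∧ RotatedUntil HasBushForm (canonicalRoot x) x ∧
        ∀ (k l : ℕ), 2 ≤ k → x = (zigzag k).nest + zigzag l → k ≤ l))

/-- Rooted trees with `n` edges. -/
abbrev RootedTree (n : ℕ) : Type := {x : DyckWord // x.semilength = n}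

/-- Plane trees with `n` edges: the classes of rooted trees under the equivalence relation
generated by rotation. -/
def PlaneTree (n : ℕ) : Type := Quot fun x y : RootedTree n => y.1 = rot x.1

/-- The plane tree underlying a rooted tree. -/
def toPlane {n : ℕ} (x : RootedTree n) : PlaneTree n := Quot.mk _ x

/-- The directed edges of `𝒯ₙ`: one for each flippable pair `(x, y)` such that `IsFlipTree x`. -/
def FlipEdge (n : ℕ) : Type :=
  {p : RootedTree n × RootedTree n // FlippablePair p.1.1 p.2.1 ∧ IsFlipTree p.1.1}

/-- The tail of a directed edge: the class of `x`. -/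
def FlipEdge.src {n : ℕ} (e : FlipEdge n) : PlaneTree n := toPlane e.1.1

/-- The head of a directed edge: the class of `y = τ(x)`. -/
def FlipEdge.tgt {n : ℕ} (e : FlipEdge n) : PlaneTree n := toPlane e.1.2

/-- There is a directed edge from `S` to `T` in `𝒯ₙ`. -/
def Arc {n : ℕ} (S T : PlaneTree n) : Prop := ∃ e : FlipEdge n, e.src = S ∧ e.tgt = T

/-- The simple graph on the nodes of `𝒯ₙ` obtained by forgetting orientations, multiplicities
and loops. -/
def underlyingGraph (n : ℕ) : SimpleGraph (PlaneTree n) := SimpleGraph.fromRel Arc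

end FlipTree

open FlipTree

/-! A flip detaches a leaf from the leftmost child `b` of the root `r` and attaches it to `r`.
`IsFlipTree` admits only flips in which all children of `b` are leaves, either one (a thin leaf) or
`k ≥ 2` (a bush), and, the tree not being a star, `r` has a further neighbor.

Every such flip raises the signature. At a thin leaf, `b` itself becomes a leaf, so the number of
leaves grows (`signature_lt_of_thin`). At a bush the number of leaves is unchanged. The moved leaf
was terminal and all other leaves keep their status, so the second entry grows unless the moved leaf
is terminal again. In that case the tree is a double star with `k` leaves at `b` and `l` at `r`, and
`k ≤ l` makes the new degree of `r` exceed the old maximum (`signature_lt_of_bush`).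

Out-degree at most one holds because the canonical rooting depends only on the rotation class
(`canonicalRoot_eq`) and the first hit of a search is unique (`IsFlipTree.eq`). A non-star has an
outgoing edge (`exists_isFlipTree`) because some rotation has the required form. The extra condition
`k ≤ l` matters only for double stars; there the canonical rooting already has bush form, and its
lexicographic minimality says `k ≤ l` (`le_of_canonicalRoot_eq`).

A finite directed graph with unique successors, a strictly increasing potential and a single sink is
a tree (`isTree_fromRel`). The geometric input is that any two adjacent vertices can be made root
and leftmost child by rotation (`exists_rerooting`). These arguments take place on binary trees, to
which words are transferred by `DyckWord.toTree`. -/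

namespace FlipTree

open BinaryTree

/-! ### Concatenation and rotation of binary trees -/

/-- Concatenation of Dyck words, on binary trees: the roots are identified. -/
def append : BinaryTree Unit → BinaryTree Unit → BinaryTree Unit
  | .nil, w => w
  | .node a u v, w => .node a u (append v w)

@[simp] lemma nil_append (w : BinaryTree Unit) : append .nil w = w := rfl

@[simp] lemma node_append (a : Unit) (u v w : BinaryTree Unit) :
    append (.node a u v) w = .node a u (append v w) := rfl

@[simp] lemma append_nil (t : BinaryTree Unit) : append t .nil = t := by
  induction t with
  | nil => rfl
  | node a u v _ ih => simp [ih]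

lemma append_assoc (s t w : BinaryTree Unit) :
    append (append s t) w = append s (append t w) := by
  induction s with
  | nil => rfl
  | node a u v _ ih => simp [ih]

@[simp] lemma numNodes_append (s t : BinaryTree Unit) :
    (append s t).numNodes = s.numNodes + t.numNodes := by
  induction s with
  | nil => simp
  | node a u v _ ih => simp [ih]; omega

/-- Tree rotation on binary trees. -/
def treeRot : BinaryTree Unit → BinaryTree Unit
  | .nil => .nil
  | .node a u v => append u (.node a v .nil)

/-- `t'` is an iterated rotation of `t`. -/
def RotEq (t t' : BinaryTree Unit) : Prop := ∃ r : ℕ, treeRot^[r] t = t'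

lemma RotEq.refl (t : BinaryTree Unit) : RotEq t t := ⟨0, rfl⟩

lemma RotEq.trans {t t' t'' : BinaryTree Unit} : RotEq t t' → RotEq t' t'' → RotEq t t'' := by
  rintro ⟨r, rfl⟩ ⟨s, rfl⟩
  exact ⟨s + r, Function.iterate_add_apply _ _ _ _⟩

/-- Each rotation moves the root along one edge of the contour walk, and the contour of `t`
traverses every edge of `t` twice. After that walk the root is back in place and `t` stands behind
`w`. -/
lemma treeRot_iterate_append (t w : BinaryTree Unit) :
    treeRot^[2 * t.numNodes] (append t w) = append w t := by
  induction t generalizing w with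
  | nil => simp
  | node a u v ihu ihv =>
    have h : 2 * (node a u v).numNodes
        = 2 * v.numNodes + (1 + (2 * u.numNodes + 1)) := by simp; ring
    rw [h, Function.iterate_add_apply, Function.iterate_add_apply _ 1]
    rw [Function.iterate_one, Function.iterate_succ_apply, node_append, treeRot]
    rw [ihu, node_append, nil_append, treeRot, append_assoc, ihv, append_assoc]
    rfl

lemma treeRot_iterate_self (t : BinaryTree Unit) : treeRot^[2 * t.numNodes] t = t := by
  simpa using treeRot_iterate_append t .nil

lemma RotEq.append_comm (s t : BinaryTree Unit) : RotEq (append s t) (append t s) :=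
  ⟨_, treeRot_iterate_append s t⟩

@[simp] lemma numNodes_treeRot (t : BinaryTree Unit) : (treeRot t).numNodes = t.numNodes := by
  cases t with
  | nil => rfl
  | node a u v => simp [treeRot]; omega

lemma RotEq.treeRot (t : BinaryTree Unit) : RotEq t (treeRot t) := ⟨1, rfl⟩

/-- Rotation has finite order on a given tree, so its inverse is itself a power of rotation. -/
lemma RotEq.symm {t t' : BinaryTree Unit} : RotEq t t' → RotEq t' t := by
  rintro ⟨r, rfl⟩
  induction r with
  | zero => exact .refl _
  | succ r ih =>
    refine RotEq.trans ?_ ih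
    rw [Function.iterate_succ_apply']
    generalize FlipTree.treeRot^[r] t = s
    cases s with
    | nil => exact .refl _
    | node a u v =>
      refine ⟨2 * (node a u v).numNodes - 1, ?_⟩
      rw [← Function.iterate_succ_apply]
      exact treeRot_iterate_self (node a u v)

lemma RotEq.swap (a : Unit) (u v : BinaryTree Unit) : RotEq (.node a u v) (.node a v u) :=
  (RotEq.treeRot _).trans (RotEq.append_comm u (.node a v .nil))

lemma RotEq.cycle (a : Unit) (u v : BinaryTree Unit) :
    RotEq (.node a u v) (append v (.node a u .nil)) :=
  RotEq.append_comm (.node a u .nil) v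

lemma RotEq.numNodes_eq {t t' : BinaryTree Unit} : RotEq t t' → t'.numNodes = t.numNodes := by
  rintro ⟨r, rfl⟩
  induction r with
  | zero => rfl
  | succ r ih => rw [Function.iterate_succ_apply', numNodes_treeRot, ih]

/-- The star rooted at its center. -/
def treeStar : ℕ → BinaryTree Unit
  | 0 => .nil
  | k + 1 => .node () .nil (treeStar k)

/-! ### The graph of a tree -/

section Adj

variable {a : Unit} {u v : BinaryTree Unit}

/-- The inclusion of the vertices of the leftmost subtree. -/
def Vert.inl (p : Vert u) : Vert (.node a u v) := Sum.inl p

/-- The inclusion of the vertices of the remaining tree. -/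
def Vert.inr (p : Vert v) : Vert (.node a u v) := Sum.inr p

@[elab_as_elim]
lemma Vert.node_cases {motive : Vert (.node a u v) → Prop} (inl : ∀ p, motive (.inl p))
    (inr : ∀ p, motive (.inr p)) (p : Vert (.node a u v)) : motive p :=
  match p with
  | .inl p => inl p
  | .inr p => inr p

lemma Vert.inl_injective : Function.Injective (Vert.inl : Vert u → Vert (.node a u v)) :=
  Sum.inl_injective

lemma Vert.inr_injective : Function.Injective (Vert.inr : Vert v → Vert (.node a u v)) :=
  Sum.inr_injective

@[simp] lemma Vert.inl_inj {p q : Vert u} : (.inl p : Vert (.node a u v)) = .inl q ↔ p = q :=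
  Vert.inl_injective.eq_iff

@[simp] lemma Vert.inr_inj {p q : Vert v} : (.inr p : Vert (.node a u v)) = .inr q ↔ p = q :=
  Vert.inr_injective.eq_iff

@[simp] lemma Vert.inl_ne_inr {p : Vert u} {q : Vert v} :
    (.inl p : Vert (.node a u v)) ≠ .inr q := fun h => Sum.inl_ne_inr h

@[simp] lemma Vert.inr_ne_inl {p : Vert v} {q : Vert u} :
    (.inr p : Vert (.node a u v)) ≠ .inl q := fun h => Sum.inr_ne_inl h

@[simp] lemma root_node : root (.node a u v) = .inr (root v) := rfl

@[simp] lemma leftmostChild_node : leftmostChild (.node a u v) = .inl (root u) := rfl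

@[simp] lemma adj_inl_inl {p q : Vert u} :
    (treeGraph (.node a u v)).Adj (.inl p) (.inl q) ↔ (treeGraph u).Adj p q := by
  change ((treeGraph u ⊕g treeGraph v) ⊔ SimpleGraph.edge _ _).Adj (Sum.inl p) (Sum.inl q) ↔ _
  simp [SimpleGraph.edge_adj]

@[simp] lemma adj_inr_inr {p q : Vert v} :
    (treeGraph (.node a u v)).Adj (.inr p) (.inr q) ↔ (treeGraph v).Adj p q := by
  change ((treeGraph u ⊕g treeGraph v) ⊔ SimpleGraph.edge _ _).Adj (Sum.inr p) (Sum.inr q) ↔ _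
  simp [SimpleGraph.edge_adj]

@[simp] lemma adj_inl_inr {p : Vert u} {q : Vert v} :
    (treeGraph (.node a u v)).Adj (.inl p) (.inr q) ↔ p = root u ∧ q = root v := by
  change ((treeGraph u ⊕g treeGraph v) ⊔ SimpleGraph.edge _ _).Adj (Sum.inl p) (Sum.inr q) ↔ _
  simp [SimpleGraph.edge_adj]

@[simp] lemma adj_inr_inl {p : Vert v} {q : Vert u} :
    (treeGraph (.node a u v)).Adj (.inr p) (.inl q) ↔ q = root u ∧ p = root v := by
  rw [SimpleGraph.adj_comm, adj_inl_inr]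

end Adj

@[simp] lemma not_adj_nil (p q : Vert .nil) : ¬ (treeGraph .nil).Adj p q := fun h => h

instance : Unique (Vert .nil) := inferInstanceAs (Unique Unit)

lemma connected_treeGraph : ∀ t : BinaryTree Unit, (treeGraph t).Connected
  | .nil => ⟨fun p q => Subsingleton.elim p q ▸ .rfl⟩
  | .node _ u v => (connected_treeGraph u).sum_sup_edge (connected_treeGraph v)

/-- Exchanging the roles of the root and its leftmost child. -/
def swapIso (a : Unit) (u v : BinaryTree Unit) :
    treeGraph (.node a u v) ≃g treeGraph (.node a v u) where
  toEquiv := Equiv.sumComm (Vert u) (Vert v)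
  map_rel_iff' := by
    refine @fun p q => Vert.node_cases (fun p => ?_) (fun p => ?_) p <;>
      refine Vert.node_cases (fun q => ?_) (fun q => ?_) q
    · exact adj_inr_inr.trans adj_inl_inl.symm
    · exact adj_inr_inl.trans (and_comm.trans adj_inl_inr.symm)
    · exact adj_inl_inr.trans (and_comm.trans adj_inr_inl.symm)
    · exact adj_inl_inl.trans adj_inr_inr.symm

@[simp] lemma swapIso_inl {a : Unit} {u v : BinaryTree Unit} (p : Vert u) :
    swapIso a u v (.inl p) = .inr p := rfl

@[simp] lemma swapIso_inr {a : Unit} {u v : BinaryTree Unit} (p : Vert v) :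
    swapIso a u v (.inr p) = .inl p := rfl

section Shuffle

variable (a b : Unit) {u y u₁ z : BinaryTree Unit}
  (φ : treeGraph (.node a u y) ≃g treeGraph z)

/-- Exchanging the first two children of the root, on vertices. -/
def shuffleEquiv : Vert (.node a u (.node b u₁ y)) ≃ Vert (.node b u₁ z) :=
  (((Equiv.sumAssoc (Vert u) (Vert u₁) (Vert y)).symm.trans
    ((Equiv.sumComm _ _).sumCongr (Equiv.refl _))).trans (Equiv.sumAssoc _ _ _)).trans
      ((Equiv.refl (Vert u₁)).sumCongr φ.toEquiv)

@[simp] lemma shuffleEquiv_inl (p : Vert u) :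
    shuffleEquiv a b φ (.inl p : Vert (.node a u (.node b u₁ y))) = .inr (φ (.inl p)) := rfl

@[simp] lemma shuffleEquiv_inr_inl (p : Vert u₁) :
    shuffleEquiv a b φ (.inr (.inl p) : Vert (.node a u (.node b u₁ y))) = .inl p := rfl

@[simp] lemma shuffleEquiv_inr_inr (p : Vert y) :
    shuffleEquiv a b φ (.inr (.inr p) : Vert (.node a u (.node b u₁ y))) = .inr (φ (.inr p)) := rfl

/-- Exchanging the first two children of the root, up to an isomorphism fixing the root. -/
def shuffleIso (h : φ (root _) = root z) :
    treeGraph (.node a u (.node b u₁ y)) ≃g treeGraph (.node b u₁ z) where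
  toEquiv := shuffleEquiv a b φ
  map_rel_iff' := by
    have hr : ∀ p, φ p = root z ↔ p = root _ := fun p => by rw [← h, φ.injective.eq_iff]
    refine @fun p q => Vert.node_cases (fun p => ?_)
        (Vert.node_cases (fun p => ?_) (fun p => ?_)) p <;>
      refine Vert.node_cases (fun q => ?_) (Vert.node_cases (fun q => ?_) (fun q => ?_)) q <;>
      simp [hr, φ.map_adj_iff, and_comm]

end Shuffle

/-! ### Rerooting at an arbitrary edge -/

/-- The vertices of `v` in the concatenation of `v` and `w`. -/
def embed : (v w : BinaryTree Unit) → Vert v → Vert (append v w)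
  | .nil, w, _ => root w
  | .node _ _ _, _, .inl p => Vert.inl p
  | .node _ _ v, w, .inr p => Vert.inr (embed v w p)

section Embed

variable {a : Unit} {u v : BinaryTree Unit}

@[simp] lemma embed_inl (w : BinaryTree Unit) (p : Vert u) :
    embed (.node a u v) w (.inl p) = Vert.inl p := rfl

@[simp] lemma embed_inr (w : BinaryTree Unit) (p : Vert v) :
    embed (.node a u v) w (.inr p) = Vert.inr (embed v w p) := rfl

@[simp] lemma embed_root (v w : BinaryTree Unit) : embed v w (root v) = root (append v w) := by
  induction v with
  | nil => rfl
  | node a u v _ ih => simp [ih]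

end Embed

/-- The subtree `s` is moved past the children of the root one at a time by `shuffleIso`. The images
of the vertices of `y` are recorded so that a chosen edge can be followed through successive
rotations. -/
lemma exists_cycleIso (s y : BinaryTree Unit) :
    ∃ φ : treeGraph (.node () s y) ≃g treeGraph (append y (.node () s .nil)),
      ∀ p, φ (.inr p) = embed y _ p := by
  induction y with
  | nil => exact ⟨.refl, fun p => congrArg Vert.inr (Subsingleton.elim p (root .nil))⟩
  | node a u y _ ih =>
    obtain ⟨φ, h⟩ := ih
    refine ⟨shuffleIso () a φ (by simp [h]), ?_⟩
    refine Vert.node_cases (fun p => ?_) (fun p => ?_)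
    · rfl
    · exact congrArg Vert.inr (h p)

lemma exists_cycleIso_append (s v w : BinaryTree Unit) :
    ∃ φ : treeGraph (.node () s (append v w)) ≃g treeGraph (append v (append w (.node () s .nil))),
      ∀ p, φ (.inr (embed v w p)) = embed v _ p := by
  induction v with
  | nil =>
    obtain ⟨φ, h⟩ := exists_cycleIso s w
    exact ⟨φ, fun p => (h _).trans (embed_root _ _)⟩
  | node a u v _ ih =>
    obtain ⟨φ, h⟩ := ih
    have hr := h (root v)
    simp only [embed_root] at hr
    refine ⟨shuffleIso () a φ hr, ?_⟩
    refine Vert.node_cases (fun p => ?_) (fun p => ?_)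
    · rfl
    · exact congrArg Vert.inr (h p)

/-- Every pair of adjacent vertices of `t` occurs, in a suitable rotation, as the root and its
leftmost child. The tree `t` may be a part of a larger tree. -/
lemma exists_rerooting_append (t w : BinaryTree Unit) (p q : Vert t) (h : (treeGraph t).Adj p q) :
    ∃ u v, RotEq (append t w) (.node () u v) ∧
      ∃ φ : treeGraph (.node () u v) ≃g treeGraph (append t w),
        φ (.inr (root v)) = embed t w p ∧ φ (.inl (root u)) = embed t w q := by
  induction t generalizing w with
  | nil => exact absurd h (not_adj_nil _ _)
  | node a u v ihu ihv =>
    induction p using Vert.node_cases with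
    | inl p =>
      induction q using Vert.node_cases with
      | inl q =>
        -- For an edge inside `u`, swapping root and leftmost child and then cycling puts `u` first,
        -- and everything else becomes its new context.
        obtain ⟨φ, hφ⟩ := exists_cycleIso (append v w) u
        obtain ⟨u', v', hr, ψ, hp, hq⟩ := ihu (.node () (append v w) .nil) p q (adj_inl_inl.1 h)
        have key : ∀ {x p}, ψ x = embed u _ p → swapIso _ _ _ (φ.symm (ψ x)) = Vert.inl p :=
          fun {x p} hx => by rw [hx, ← hφ, φ.symm_apply_apply]; rfl
        refine ⟨u', v', ((RotEq.swap _ _ _).trans (RotEq.cycle _ _ _)).trans hr,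
          ψ.trans (φ.symm.trans (swapIso _ _ _)), key hp, key hq⟩
      | inr q =>
        obtain ⟨rfl, rfl⟩ := adj_inl_inr.1 h
        exact ⟨append v w, u, RotEq.swap _ _ _, swapIso _ _ _, rfl,
          congrArg Vert.inr (embed_root _ _).symm⟩
    | inr p =>
      induction q using Vert.node_cases with
      | inl q =>
        obtain ⟨rfl, rfl⟩ := adj_inr_inl.1 h
        exact ⟨u, append v w, RotEq.refl _, .refl,
          congrArg Vert.inr (embed_root _ _).symm, rfl⟩
      | inr q =>
        obtain ⟨φ, hφ⟩ := exists_cycleIso_append u v w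
        obtain ⟨u', v', hr, ψ, hp, hq⟩ := ihv (append w (.node () u .nil)) p q (adj_inr_inr.1 h)
        have key : ∀ {x p}, ψ x = embed v _ p → φ.symm (ψ x) = Vert.inr (embed v w p) :=
          fun {x p} hx => by rw [hx, ← hφ, φ.symm_apply_apply]
        refine ⟨u', v', (RotEq.cycle a u (append v w)).trans ?_, ψ.trans φ.symm, key hp, key hq⟩
        rwa [append_assoc]

/-- Every pair of adjacent vertices occurs, in a suitable rotation, as the root and its leftmost
child. -/
theorem exists_rerooting {t : BinaryTree Unit} {p q : Vert t} (h : (treeGraph t).Adj p q) :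
    ∃ u v, RotEq t (.node () u v) ∧
      ∃ φ : treeGraph (.node () u v) ≃g treeGraph t,
        φ (.inr (root v)) = p ∧ φ (.inl (root u)) = q := by
  -- The induction step is unfolded once with empty context, which avoids transporting vertices
  -- along `append_nil`.
  cases t with
  | nil => exact absurd h (not_adj_nil _ _)
  | node a u v =>
    induction p using Vert.node_cases with
    | inl p =>
      induction q using Vert.node_cases with
      | inl q =>
        obtain ⟨φ, hφ⟩ := exists_cycleIso v u
        obtain ⟨u', v', hr, ψ, hp, hq⟩ :=
          exists_rerooting_append u (.node () v .nil) p q (adj_inl_inl.1 h)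
        have key : ∀ {x p}, ψ x = embed u _ p → swapIso _ _ _ (φ.symm (ψ x)) = Vert.inl p :=
          fun {x p} hx => by rw [hx, ← hφ, φ.symm_apply_apply]; rfl
        exact ⟨u', v', ((RotEq.swap _ _ _).trans (RotEq.cycle _ _ _)).trans hr,
          ψ.trans (φ.symm.trans (swapIso _ _ _)), key hp, key hq⟩
      | inr q =>
        obtain ⟨rfl, rfl⟩ := adj_inl_inr.1 h
        exact ⟨v, u, RotEq.swap _ _ _, swapIso _ _ _, rfl, rfl⟩
    | inr p =>
      induction q using Vert.node_cases with
      | inl q =>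
        obtain ⟨rfl, rfl⟩ := adj_inr_inl.1 h
        exact ⟨u, v, RotEq.refl _, .refl, rfl, rfl⟩
      | inr q =>
        obtain ⟨φ, hφ⟩ := exists_cycleIso u v
        obtain ⟨u', v', hr, ψ, hp, hq⟩ :=
          exists_rerooting_append v (.node () u .nil) p q (adj_inr_inr.1 h)
        have key : ∀ {x p}, ψ x = embed v _ p → φ.symm (ψ x) = Vert.inr p :=
          fun {x p} hx => by rw [hx, ← hφ, φ.symm_apply_apply]
        exact ⟨u', v', (RotEq.cycle a u v).trans hr, ψ.trans φ.symm, key hp, key hq⟩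

/-- Rotation does not change the underlying abstract tree. -/
lemma RotEq.nonempty_iso {t t' : BinaryTree Unit} (h : RotEq t t') :
    Nonempty (treeGraph t ≃g treeGraph t') := by
  obtain ⟨r, rfl⟩ := h
  induction r with
  | zero => exact ⟨.refl⟩
  | succ r ih =>
    obtain ⟨ψ⟩ := ih
    rw [Function.iterate_succ_apply']
    generalize FlipTree.treeRot^[r] t = s at *
    cases s with
    | nil => exact ⟨ψ⟩
    | node a u v =>
      obtain ⟨φ, -⟩ := exists_cycleIso v u
      exact ⟨ψ.trans ((swapIso _ _ _).trans φ)⟩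

/-! ### Isomorphism invariance -/

section Iso

variable {V W : Type*} {G : SimpleGraph V} {H : SimpleGraph W}

lemma ncard_setOf_equiv (e : V ≃ W) {P : V → Prop} {Q : W → Prop} (h : ∀ v, Q (e v) ↔ P v) :
    {w | Q w}.ncard = {v | P v}.ncard := by
  have : {w | Q w} = e '' {v | P v} := by
    ext w
    obtain ⟨v, rfl⟩ := e.surjective w
    simp [h]
  rw [this, Set.ncard_image_of_injective _ e.injective]

lemma deg_iso (φ : G ≃g H) (v : V) : deg H (φ v) = deg G v :=
  ncard_setOf_equiv φ.toEquiv fun _ => φ.map_adj_iff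

lemma isLeaf_iso (φ : G ≃g H) (v : V) : IsLeaf H (φ v) ↔ IsLeaf G v := by
  rw [IsLeaf, IsLeaf, deg_iso]

lemma exists_isThinLeaf_of_iso (φ : G ≃g H) (h : ∃ v, IsThinLeaf G v) : ∃ v, IsThinLeaf H v := by
  obtain ⟨v, hv, w, hw, hd⟩ := h
  exact ⟨φ v, (isLeaf_iso φ v).2 hv, φ w, φ.map_adj_iff.2 hw, (deg_iso φ w).trans hd⟩

lemma exists_isThinLeaf_iso (φ : G ≃g H) : (∃ v, IsThinLeaf H v) ↔ ∃ v, IsThinLeaf G v :=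
  ⟨exists_isThinLeaf_of_iso φ.symm, exists_isThinLeaf_of_iso φ⟩

lemma isStar_of_iso (φ : G ≃g H) (h : IsStar G) : IsStar H := fun v hv w hw =>
  φ.symm.injective (h (fun hl => hv ((isLeaf_iso φ.symm v).1 hl))
    (fun hl => hw ((isLeaf_iso φ.symm w).1 hl)))

lemma isStar_iso (φ : G ≃g H) : IsStar H ↔ IsStar G := ⟨isStar_of_iso φ.symm, isStar_of_iso φ⟩

lemma deg_skeleton (w : {v // ¬ IsLeaf G v}) :
    deg (skeleton G) w = {v | G.Adj w v ∧ ¬ IsLeaf G v}.ncard := by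
  rw [deg, ← Set.ncard_image_of_injective _ Subtype.val_injective]
  congr 1
  ext v
  constructor
  · rintro ⟨x, hx, rfl⟩
    exact ⟨hx, x.2⟩
  · rintro ⟨h, hv⟩
    exact ⟨⟨v, hv⟩, h, rfl⟩

/-- Counting non-leaf neighbors inside `G` replaces degrees in the skeleton, which lives on a
subtype and is awkward to compare between two graphs. -/
lemma isTerminalLeaf_iff {v : V} : IsTerminalLeaf G v ↔ IsLeaf G v ∧
    ∃ w, G.Adj v w ∧ ¬ IsLeaf G w ∧ {w' | G.Adj w w' ∧ ¬ IsLeaf G w'}.ncard = 1 := by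
  simp only [IsTerminalLeaf, Subtype.exists]
  refine and_congr_right fun _ => exists_congr fun w => ?_
  constructor
  · rintro ⟨h, ha, hl⟩
    exact ⟨ha, h, (deg_skeleton _).symm.trans hl⟩
  · rintro ⟨ha, h, hl⟩
    exact ⟨h, ha, (deg_skeleton _).trans hl⟩

lemma isTerminalLeaf_iso (φ : G ≃g H) (v : V) : IsTerminalLeaf H (φ v) ↔ IsTerminalLeaf G v := by
  rw [isTerminalLeaf_iff, isTerminalLeaf_iff, isLeaf_iso, ← φ.toEquiv.exists_congr_right]
  refine and_congr_right fun _ => exists_congr fun w => ?_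
  refine and_congr φ.map_adj_iff (and_congr (not_congr (isLeaf_iso φ w)) ?_)
  rw [ncard_setOf_equiv φ.toEquiv]
  exact fun w' => and_congr φ.map_adj_iff (not_congr (isLeaf_iso φ w'))

lemma graphSignature_iso (φ : G ≃g H) : graphSignature H = graphSignature G := by
  unfold graphSignature
  rw [ncard_setOf_equiv φ.toEquiv (isLeaf_iso φ), ncard_setOf_equiv φ.toEquiv
    (fun v => and_congr (isLeaf_iso φ v) (not_congr (isTerminalLeaf_iso φ v))),
    ← φ.toEquiv.iSup_congr (g := deg H) (f := deg G) (fun v => deg_iso φ v)]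

lemma edist_iso_le (φ : G ≃g H) (v w : V) : H.edist (φ v) (φ w) ≤ G.edist v w :=
  le_iInf fun p => by simpa using! SimpleGraph.Walk.edist_le (p.map φ.toHom)

lemma edist_iso (φ : G ≃g H) (v w : V) : H.edist (φ v) (φ w) = G.edist v w :=
  le_antisymm (edist_iso_le φ v w) (by simpa using edist_iso_le φ.symm (φ v) (φ w))

lemma eccent_iso (φ : G ≃g H) (v : V) : H.eccent (φ v) = G.eccent v := by
  unfold SimpleGraph.eccent
  exact (φ.toEquiv.iSup_congr fun w => edist_iso φ v w).symm

lemma radius_iso (φ : G ≃g H) : H.radius = G.radius := by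
  unfold SimpleGraph.radius
  exact (φ.toEquiv.iInf_congr fun w => eccent_iso φ w).symm

lemma mem_center_iso (φ : G ≃g H) (v : V) : φ v ∈ H.center ↔ v ∈ G.center := by
  rw [SimpleGraph.mem_center_iff, SimpleGraph.mem_center_iff, eccent_iso, radius_iso φ]

lemma ncard_center_iso (φ : G ≃g H) : H.center.ncard = G.center.ncard :=
  ncard_setOf_equiv φ.toEquiv (mem_center_iso φ)

end Iso

/-! ### Degrees -/

section Degree

variable {a : Unit} {u v : BinaryTree Unit}

lemma deg_inl_of_ne {p : Vert u} (h : p ≠ root u) :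
    deg (treeGraph (.node a u v)) (.inl p) = deg (treeGraph u) p := by
  have : (treeGraph (.node a u v)).neighborSet (.inl p)
      = Vert.inl '' (treeGraph u).neighborSet p := by
    ext q
    induction q using Vert.node_cases <;> simp [h]
  rw [deg, this, Set.ncard_image_of_injective _ Vert.inl_injective, deg]

lemma deg_inl_root :
    deg (treeGraph (.node a u v)) (.inl (root u)) = deg (treeGraph u) (root u) + 1 := by
  have : (treeGraph (.node a u v)).neighborSet (.inl (root u))
      = insert (.inr (root v)) (Vert.inl '' (treeGraph u).neighborSet (root u)) := by
    ext q
    induction q using Vert.node_cases <;> simp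
  rw [deg, this, Set.ncard_insert_of_notMem (by simp) (Set.toFinite _),
    Set.ncard_image_of_injective _ Vert.inl_injective, deg]

lemma deg_inr_of_ne {p : Vert v} (h : p ≠ root v) :
    deg (treeGraph (.node a u v)) (.inr p) = deg (treeGraph v) p := by
  rw [← deg_iso (swapIso a u v), swapIso_inr, deg_inl_of_ne h]

lemma deg_inr_root :
    deg (treeGraph (.node a u v)) (.inr (root v)) = deg (treeGraph v) (root v) + 1 := by
  rw [← deg_iso (swapIso a u v), swapIso_inr, deg_inl_root]

@[simp] lemma deg_nil (p : Vert .nil) : deg (treeGraph .nil) p = 0 := by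
  have : (treeGraph .nil).neighborSet p = ∅ := by ext q; simp
  rw [deg, this, Set.ncard_empty]

lemma deg_root_eq_zero {t : BinaryTree Unit} : deg (treeGraph t) (root t) = 0 ↔ t = .nil := by
  cases t with
  | nil => simp
  | node a u v => simp [deg_inr_root]

lemma deg_root_pos {t : BinaryTree Unit} (h : t ≠ .nil) : 0 < deg (treeGraph t) (root t) :=
  Nat.pos_of_ne_zero fun h' => h (deg_root_eq_zero.1 h')

end Degree

/-! ### Stars -/

@[simp] lemma numNodes_treeStar (k : ℕ) : (treeStar k).numNodes = k := by
  induction k with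
  | zero => rfl
  | succ k ih => simp [treeStar, ih]

@[simp] lemma deg_treeStar_root (k : ℕ) : deg (treeGraph (treeStar k)) (root _) = k := by
  induction k with
  | zero => exact deg_nil _
  | succ k ih => exact deg_inr_root.trans (congrArg (· + 1) ih)

lemma isLeaf_treeStar {k : ℕ} {p : Vert (treeStar k)} (h : p ≠ root _) :
    IsLeaf (treeGraph (treeStar k)) p := by
  induction k with
  | zero => exact absurd (Subsingleton.elim (α := Vert .nil) p _) h
  | succ k ih =>
    refine Vert.node_cases (a := ()) (u := .nil) (v := treeStar k)
      (motive := fun p => p ≠ root _ → IsLeaf (treeGraph (.node () .nil (treeStar k))) p)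
      (fun p _ => ?_) (fun p hp => ?_) p h
    · rw [IsLeaf, Subsingleton.elim p (root .nil), deg_inl_root, deg_nil]
    · have hp' : p ≠ root _ := fun h => hp (h ▸ rfl)
      exact (deg_inr_of_ne hp').trans (ih hp')

lemma eq_treeStar_of_adj {t : BinaryTree Unit}
    (h : ∀ p, (treeGraph t).Adj (root t) p → IsLeaf (treeGraph t) p) :
    t = treeStar t.numNodes := by
  induction t with
  | nil => rfl
  | node a u v _ ihv =>
    have hu : u = .nil := by
      have := h (.inl (root u)) (by simp)
      rw [IsLeaf, deg_inl_root, Nat.add_eq_right] at this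
      exact deg_root_eq_zero.1 this
    subst hu
    have hv := ihv fun p hp =>
      (deg_inr_of_ne hp.ne').symm.trans (h (.inr p) (adj_inr_inr.2 hp))
    rw [numNodes, numNodes, Nat.zero_add, treeStar, ← hv]

lemma eq_treeStar {t : BinaryTree Unit} (h : ∀ p ≠ root t, IsLeaf (treeGraph t) p) :
    t = treeStar t.numNodes :=
  eq_treeStar_of_adj fun p hp => h p hp.ne'

lemma isStar_treeStar (k : ℕ) : IsStar (treeGraph (treeStar k)) := by
  have : ∀ p, p ∈ {v | ¬ IsLeaf (treeGraph (treeStar k)) v} → p = root _ := fun p hp => by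
    by_contra h
    exact hp (isLeaf_treeStar h)
  exact fun p hp q hq => (this p hp).trans (this q hq).symm

lemma exists_adj {t : BinaryTree Unit} (ht : t ≠ .nil) (p : Vert t) :
    ∃ q, (treeGraph t).Adj p q := by
  cases t with
  | nil => exact absurd rfl ht
  | node a u v =>
    have : Nontrivial (Vert (.node a u v)) := ⟨.inl (root u), .inr (root v), by simp⟩
    exact (connected_treeGraph _).preconnected.exists_adj_of_nontrivial p

lemma rotEq_treeStar {t : BinaryTree Unit} (h : IsStar (treeGraph t)) :
    RotEq t (treeStar t.numNodes) := by
  by_cases hl : ∀ p ≠ root t, IsLeaf (treeGraph t) p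
  · exact eq_treeStar hl ▸ .refl _
  · push Not at hl
    obtain ⟨p, hpr, hp⟩ := hl
    have ht : t ≠ .nil := by
      rintro rfl
      exact hpr (Subsingleton.elim (α := Vert .nil) _ _)
    -- Any neighbor of `p` serves as leftmost child: only the root position matters, and every
    -- vertex other than the non-leaf `p` is a leaf.
    obtain ⟨q, hq⟩ := exists_adj ht p
    obtain ⟨u, v, hr, φ, hφ, -⟩ := exists_rerooting hq
    rw [← hr.numNodes_eq]
    convert! hr
    refine (eq_treeStar fun x hx => ?_).symm
    by_contra hl
    refine hx (φ.injective ?_)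
    rw [root_node, hφ]
    exact h (fun h' => hl ((isLeaf_iso φ x).1 h')) hp

/-! ### The signature increases along flips -/

section Flip

/-- Terminality of a leaf `p` is decided by its neighbor and that vertex's non-leaf neighbors. None
of these is the leaf `i`, so moving `i` can change the terminality of no leaf but `i`. -/
lemma isTerminalLeaf_congr {V W : Type*} {G : SimpleGraph V} {H : SimpleGraph W} (e : V ≃ W)
    {i : V} (hi : IsLeaf G i) (hl : ∀ p, IsLeaf H (e p) ↔ IsLeaf G p)
    (ha : ∀ p q, p ≠ i → q ≠ i → (H.Adj (e p) (e q) ↔ G.Adj p q)) {p : V} (hp : p ≠ i) :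
    IsTerminalLeaf H (e p) ↔ IsTerminalLeaf G p := by
  have hne : ∀ {q}, ¬ IsLeaf G q → q ≠ i := fun hq h => hq (h ▸ hi)
  rw [isTerminalLeaf_iff, isTerminalLeaf_iff, hl, ← e.exists_congr_right]
  refine and_congr_right fun _ => exists_congr fun w => ?_
  rw [hl, ← and_assoc, ← and_assoc]
  have key : ¬ IsLeaf G w → {w' | H.Adj (e w) w' ∧ ¬ IsLeaf H w'}.ncard
      = {w' | G.Adj w w' ∧ ¬ IsLeaf G w'}.ncard := fun hw =>
    ncard_setOf_equiv e fun w' => by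
      rw [hl]
      exact and_congr_left fun hw' => ha _ _ (hne hw) (hne hw')
  constructor
  · rintro ⟨⟨h, hw⟩, hc⟩
    exact ⟨⟨(ha _ _ hp (hne hw)).1 h, hw⟩, (key hw).symm.trans hc⟩
  · rintro ⟨⟨h, hw⟩, hc⟩
    exact ⟨⟨(ha _ _ hp (hne hw)).2 h, hw⟩, (key hw).trans hc⟩

/-- The tree `110w0v`. -/
abbrev flipSrc (w v : BinaryTree Unit) : BinaryTree Unit := .node () (.node () .nil w) v

/-- The tree `101w0v`. -/
abbrev flipTgt (w v : BinaryTree Unit) : BinaryTree Unit := .node () .nil (.node () w v)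

variable (w v : BinaryTree Unit)

/-- The identification of the vertices of `110w0v` with those of `101w0v`. -/
def flipEquiv : Vert (flipSrc w v) ≃ Vert (flipTgt w v) :=
  Equiv.sumAssoc (Vert .nil) (Vert w) (Vert v)

/-- The leaf that is moved. -/
abbrev flipLeaf : Vert (flipSrc w v) := .inl (.inl (root .nil))

variable {w v}

@[elab_as_elim]
lemma flipSrc_cases {motive : Vert (flipSrc w v) → Prop} (leaf : motive (flipLeaf w v))
    (left : ∀ p, motive (.inl (.inr p))) (right : ∀ p, motive (.inr p)) (p : Vert (flipSrc w v)) :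
    motive p :=
  Vert.node_cases (Vert.node_cases (fun p => Subsingleton.elim (root .nil) p ▸ leaf) left) right p

@[simp] lemma flipEquiv_leaf : flipEquiv w v (flipLeaf w v) = .inl (root .nil) := rfl

@[simp] lemma flipEquiv_left (p : Vert w) : flipEquiv w v (.inl (.inr p)) = .inr (.inl p) := rfl

@[simp] lemma flipEquiv_right (p : Vert v) : flipEquiv w v (.inr p) = .inr (.inr p) := rfl

lemma flipEquiv_adj (p q : Vert (flipSrc w v)) (hp : p ≠ flipLeaf w v) (hq : q ≠ flipLeaf w v) :
    (treeGraph (flipTgt w v)).Adj (flipEquiv w v p) (flipEquiv w v q) ↔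
      (treeGraph (flipSrc w v)).Adj p q := by
  induction p using flipSrc_cases with
  | leaf => exact absurd rfl hp
  | left p => induction q using flipSrc_cases <;> simp at hq ⊢
  | right p => induction q using flipSrc_cases <;> simp at hq ⊢

lemma isLeaf_flipLeaf : IsLeaf (treeGraph (flipSrc w v)) (flipLeaf w v) := by
  rw [IsLeaf, deg_inl_of_ne (by simp), deg_inl_root, deg_nil]

lemma isLeaf_flipEquiv_flipLeaf :
    IsLeaf (treeGraph (flipTgt w v)) (flipEquiv w v (flipLeaf w v)) := by
  rw [IsLeaf, flipEquiv_leaf, deg_inl_root, deg_nil]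

lemma deg_flipSrc_left :
    deg (treeGraph (flipSrc w v)) (.inl (.inr (root w))) = deg (treeGraph w) (root w) + 2 :=
  deg_inl_root.trans (congrArg (· + 1) deg_inr_root)

lemma deg_flipTgt_left :
    deg (treeGraph (flipTgt w v)) (.inr (.inl (root w))) = deg (treeGraph w) (root w) + 1 :=
  (deg_inr_of_ne (by simp)).trans deg_inl_root

lemma deg_flipTgt_right :
    deg (treeGraph (flipTgt w v)) (.inr (.inr (root v))) = deg (treeGraph v) (root v) + 2 :=
  deg_inr_root.trans (congrArg (· + 1) deg_inr_root)

lemma deg_flipEquiv_left {p : Vert w} (hp : p ≠ root w) :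
    deg (treeGraph (flipTgt w v)) (.inr (.inl p)) =
      deg (treeGraph (flipSrc w v)) (.inl (.inr p)) := by
  rw [deg_inr_of_ne (by simp), deg_inl_of_ne hp, deg_inl_of_ne (by simpa using hp),
    deg_inr_of_ne hp]

lemma deg_flipEquiv_right {p : Vert v} (hp : p ≠ root v) :
    deg (treeGraph (flipTgt w v)) (.inr (.inr p)) = deg (treeGraph (flipSrc w v)) (.inr p) := by
  rw [deg_inr_of_ne (by simpa using hp), deg_inr_of_ne hp, deg_inr_of_ne hp]

lemma not_isLeaf_flipSrc_right (hv : v ≠ .nil) :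
    ¬ IsLeaf (treeGraph (flipSrc w v)) (.inr (root v)) := by
  have := deg_root_pos hv
  rw [IsLeaf, deg_inr_root]
  omega

lemma not_isLeaf_flipTgt_right : ¬ IsLeaf (treeGraph (flipTgt w v)) (.inr (.inr (root v))) := by
  rw [IsLeaf, deg_flipTgt_right]
  omega

lemma not_isLeaf_flipSrc_left :
    ¬ IsLeaf (treeGraph (flipSrc w v)) (.inl (.inr (root w))) := by
  rw [IsLeaf, deg_flipSrc_left]
  omega

/-- Only the old and the new neighbor of the moved leaf change degree. The old one is excluded, and
the new one is internal before and after because `v` is nonempty. -/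
lemma isLeaf_flipEquiv_of_ne (hv : v ≠ .nil) {p : Vert (flipSrc w v)}
    (hp : p ≠ .inl (.inr (root w))) :
    IsLeaf (treeGraph (flipTgt w v)) (flipEquiv w v p) ↔ IsLeaf (treeGraph (flipSrc w v)) p := by
  induction p using flipSrc_cases with
  | leaf => exact iff_of_true isLeaf_flipEquiv_flipLeaf isLeaf_flipLeaf
  | left p => rw [flipEquiv_left, IsLeaf, IsLeaf, deg_flipEquiv_left (by simpa using hp)]
  | right p =>
    by_cases h : p = root v
    · subst h
      exact iff_of_false not_isLeaf_flipTgt_right (not_isLeaf_flipSrc_right hv)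
    · rw [flipEquiv_right, IsLeaf, IsLeaf, deg_flipEquiv_right h]

lemma isLeaf_flipEquiv (hw : w ≠ .nil) (hv : v ≠ .nil) (p : Vert (flipSrc w v)) :
    IsLeaf (treeGraph (flipTgt w v)) (flipEquiv w v p) ↔ IsLeaf (treeGraph (flipSrc w v)) p := by
  by_cases hp : p = .inl (.inr (root w))
  · subst hp
    refine iff_of_false ?_ not_isLeaf_flipSrc_left
    have := deg_root_pos hw
    rw [flipEquiv_left, IsLeaf, deg_flipTgt_left]
    omega
  · exact isLeaf_flipEquiv_of_ne hv hp

/-- A flip at a thin leaf increases the number of leaves. -/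
theorem signature_lt_of_thin (hv : v ≠ .nil) :
    graphSignature (treeGraph (flipSrc .nil v)) < graphSignature (treeGraph (flipTgt .nil v)) := by
  refine Prod.Lex.toLex_lt_toLex.2 (.inl ?_)
  dsimp only
  rw [← Set.ncard_image_of_injective _ (flipEquiv .nil v).injective]
  -- The additional leaf is the former neighbor of the thin leaf, which had degree two.
  refine Set.ncard_lt_ncard ((Set.ssubset_iff_of_subset ?_).2
    ⟨flipEquiv .nil v (.inl (.inr (root .nil))), ?_, ?_⟩) (Set.toFinite _)
  · rintro _ ⟨p, hp, rfl⟩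
    exact (isLeaf_flipEquiv_of_ne hv fun h => not_isLeaf_flipSrc_left (h ▸ hp)).2 hp
  · simp [IsLeaf, deg_flipTgt_left]
  · rintro ⟨p, hp, h⟩
    exact not_isLeaf_flipSrc_left ((flipEquiv .nil v).injective h ▸ hp)

/-- Apart from the root, all neighbors of the leftmost child are leaves, and the root is not a leaf;
so the leftmost child is a leaf of the skeleton. -/
lemma isTerminalLeaf_flipLeaf {j : ℕ} (hv : v ≠ .nil) :
    IsTerminalLeaf (treeGraph (flipSrc (treeStar j) v)) (flipLeaf (treeStar j) v) := by
  refine isTerminalLeaf_iff.2 ⟨isLeaf_flipLeaf, .inl (.inr (root _)), by simp,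
    not_isLeaf_flipSrc_left, Set.ncard_eq_one.2 ⟨.inr (root v), ?_⟩⟩
  ext q
  induction q using flipSrc_cases with
  | leaf => simp [isLeaf_flipLeaf]
  | left q =>
    simp only [adj_inl_inl, adj_inr_inr, Set.mem_ofPred_eq, Set.mem_singleton_iff, Vert.inl_ne_inr,
      iff_false, not_and, not_not]
    intro h
    rw [IsLeaf, deg_inl_of_ne (by simpa using h.ne'), deg_inr_of_ne h.ne']
    exact isLeaf_treeStar h.ne'
  | right q =>
    simp only [adj_inl_inr, Set.mem_ofPred_eq, Set.mem_singleton_iff, root_node, true_and,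
      Vert.inr_inj]
    refine ⟨fun h => h.1, ?_⟩
    rintro rfl
    exact ⟨rfl, not_isLeaf_flipSrc_right hv⟩

/-- After the flip the leaf hangs on the root, whose leftover bush of `j ≥ 1` leaves provides one
non-leaf neighbor. If the leaf is terminal there is no other, so all children of the root in `v` are
leaves. -/
lemma eq_treeStar_of_isTerminalLeaf {j : ℕ} (hj : 1 ≤ j)
    (h : IsTerminalLeaf (treeGraph (flipTgt (treeStar j) v))
      (flipEquiv (treeStar j) v (flipLeaf (treeStar j) v))) : v = treeStar v.numNodes := by
  obtain ⟨-, r, hr, -, hc⟩ := isTerminalLeaf_iff.1 h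
  have hr' : r = .inr (.inr (root v)) := by
    induction r using Vert.node_cases with
    | inl r => simp at hr
    | inr r => simpa using hr
  subst hr'
  obtain ⟨c, hc⟩ := Set.ncard_eq_one.1 hc
  refine eq_treeStar_of_adj fun p hp => ?_
  by_contra hl
  have h₁ : (.inr (.inl (root (treeStar j))) : Vert (flipTgt (treeStar j) v)) ∈ ({c} : Set _) := by
    rw [← hc]
    refine ⟨by simp, ?_⟩
    rw [IsLeaf, deg_flipTgt_left, deg_treeStar_root]
    omega
  have h₂ : (.inr (.inr p) : Vert (flipTgt (treeStar j) v)) ∈ ({c} : Set _) := by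
    rw [← hc]
    refine ⟨by simpa using hp, ?_⟩
    rwa [IsLeaf, deg_inr_of_ne (by simpa using hp.ne'), deg_inr_of_ne hp.ne']
  rw [Set.mem_singleton_iff] at h₁ h₂
  simpa using h₁.trans h₂.symm

/-- Before the flip the two inner vertices have degrees `j + 2` and `l + 1`, both at most `l + 1`;
afterwards the root has degree `l + 2`. -/
lemma iSup_deg_flipSrc_lt {j l : ℕ} (h : j + 1 ≤ l) :
    ⨆ p, deg (treeGraph (flipSrc (treeStar j) (treeStar l))) p
      < ⨆ p, deg (treeGraph (flipTgt (treeStar j) (treeStar l))) p := by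
  have h₁ : ⨆ p, deg (treeGraph (flipSrc (treeStar j) (treeStar l))) p ≤ l + 1 := by
    have : Nonempty (Vert (flipSrc (treeStar j) (treeStar l))) := ⟨root _⟩
    refine ciSup_le fun p => ?_
    induction p using flipSrc_cases with
    | leaf => exact isLeaf_flipLeaf.le.trans (by omega)
    | left p =>
      by_cases hp : p = root _
      · subst hp
        rw [deg_flipSrc_left, deg_treeStar_root]
        omega
      · rw [deg_inl_of_ne (by simpa using hp), deg_inr_of_ne hp, isLeaf_treeStar hp]
        omega
    | right p =>
      by_cases hp : p = root _
      · subst hp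
        rw [deg_inr_root, deg_treeStar_root]
      · rw [deg_inr_of_ne hp, isLeaf_treeStar hp]
        omega
  have h₂ := le_ciSup (f := deg (treeGraph (flipTgt (treeStar j) (treeStar l))))
    (Set.finite_range _).bddAbove (.inr (.inr (root _)))
  rw [deg_flipTgt_right, deg_treeStar_root] at h₂
  exact h₁.trans_lt h₂

/-- A flip at a bush increases the number of non-terminal leaves or the maximum degree. -/
theorem signature_lt_of_bush {j : ℕ} (hj : 1 ≤ j) (hv : v ≠ .nil)
    (hl : ∀ l, v = treeStar l → j + 1 ≤ l) :
    graphSignature (treeGraph (flipSrc (treeStar j) v))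
      < graphSignature (treeGraph (flipTgt (treeStar j) v)) := by
  have hw : treeStar j ≠ .nil := fun h => by
    have := numNodes_treeStar j
    rw [h, numNodes] at this
    omega
  have hle := isLeaf_flipEquiv hw hv
  have ht := fun p (hp : p ≠ flipLeaf _ v) =>
    isTerminalLeaf_congr (flipEquiv _ v) isLeaf_flipLeaf hle flipEquiv_adj hp
  refine Prod.Lex.toLex_lt_toLex.2 (.inr ⟨(ncard_setOf_equiv (flipEquiv _ v) hle).symm, ?_⟩)
  refine Prod.Lex.toLex_lt_toLex.2 ?_
  -- If the moved leaf is terminal again, the tree is a double star and the maximum degree decides;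
  -- otherwise the moved leaf is a new non-terminal leaf.
  by_cases h : IsTerminalLeaf (treeGraph (flipTgt (treeStar j) v)) (flipEquiv _ v (flipLeaf _ v))
  · have hs := eq_treeStar_of_isTerminalLeaf hj h
    refine .inr ⟨(ncard_setOf_equiv (flipEquiv _ v) fun p => ?_).symm, ?_⟩
    · rw [hle]
      refine and_congr_right fun _ => not_congr ?_
      by_cases hp : p = flipLeaf _ v
      · subst hp
        exact iff_of_true h (isTerminalLeaf_flipLeaf hv)
      · exact ht p hp
    · rw [hs]
      exact iSup_deg_flipSrc_lt (hl _ hs)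
  · refine .inl ?_
    dsimp only
    rw [← Set.ncard_image_of_injective _ (flipEquiv _ v).injective]
    refine Set.ncard_lt_ncard ((Set.ssubset_iff_of_subset ?_).2
      ⟨flipEquiv _ v (flipLeaf _ v), ⟨isLeaf_flipEquiv_flipLeaf, h⟩, ?_⟩) (Set.toFinite _)
    · rintro _ ⟨p, ⟨hp, hp'⟩, rfl⟩
      refine ⟨(hle p).2 hp, fun h => hp' ((ht p fun h' => ?_).1 h)⟩
      exact hp' (h' ▸ isTerminalLeaf_flipLeaf hv)
    · rintro ⟨p, ⟨-, hp⟩, h⟩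
      exact hp ((flipEquiv _ v).injective h ▸ isTerminalLeaf_flipLeaf hv)

end Flip

/-! ### Centers -/

section Center

variable {a : Unit} {u v : BinaryTree Unit}

/-- Every path between the two sides of an edge uses the edge. -/
lemma le_edist_inl_inr (p : Vert u) (q : Vert v) :
    (treeGraph (.node a u v)).edist (.inl p) (.inl (root u)) + 1 +
        (treeGraph (.node a u v)).edist (.inr (root v)) (.inr q)
      ≤ (treeGraph (.node a u v)).edist (.inl p) (.inr q) := by
  set G := treeGraph (.node a u v) with hG
  -- Induction on the walk: a step within the left side changes the distance to `root u` by at most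
  -- one, and the first crossing leads from `root u` to `root v`.
  have key : ∀ {x y} (W : G.Walk x y) (p : Vert u), x = .inl p → y = .inr q →
      G.edist (.inl p) (.inl (root u)) + 1 + G.edist (.inr (root v)) (.inr q) ≤ W.length := by
    intro x y W
    induction W with
    | nil => rintro p rfl h; exact absurd h (by simp)
    | @cons x m y h W ih =>
      rintro p rfl rfl
      rw [SimpleGraph.Walk.length_cons, Nat.cast_add, Nat.cast_one]
      induction m using Vert.node_cases with
      | inl m =>
        have h₁ : G.edist (.inl p) (.inl (root u)) ≤ G.edist (.inl m) (.inl (root u)) + 1 := by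
          rw [add_comm, ← SimpleGraph.edist_eq_one_iff_adj.2 h]
          exact SimpleGraph.edist_triangle
        refine le_trans ?_ (add_le_add_left (ih m rfl rfl) 1)
        calc _ ≤ G.edist (.inl m) (.inl (root u)) + 1 + 1 + G.edist (.inr (root v)) (.inr q) := by
              gcongr
          _ = _ := by ring
      | inr m =>
        obtain ⟨rfl, rfl⟩ := adj_inl_inr.1 h
        rw [SimpleGraph.edist_self, zero_add, add_comm]
        gcongr
        exact SimpleGraph.Walk.edist_le W
  exact le_iInf fun W => key W p rfl rfl

lemma le_edist_inr_inl (p : Vert u) (q : Vert v) :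
    (treeGraph (.node a u v)).edist (.inr q) (.inr (root v)) + 1 +
        (treeGraph (.node a u v)).edist (.inl (root u)) (.inl p)
      ≤ (treeGraph (.node a u v)).edist (.inr q) (.inl p) := by
  have := le_edist_inl_inr (a := a) q p
  rwa [← edist_iso (swapIso a v u), ← edist_iso (swapIso a v u), ← edist_iso (swapIso a v u)]
    at this

lemma edist_ne_top (t : BinaryTree Unit) (p q : Vert t) : (treeGraph t).edist p q ≠ ⊤ :=
  SimpleGraph.edist_ne_top_iff_reachable.2 ((connected_treeGraph t).preconnected p q)

lemma one_le_edist {t : BinaryTree Unit} {p q : Vert t} (h : p ≠ q) :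
    1 ≤ (treeGraph t).edist p q :=
  Order.one_le_iff_pos.2 (pos_iff_ne_zero.2 (mt SimpleGraph.edist_eq_zero_iff.1 h))

lemma edist_inr_root_inl_root :
    (treeGraph (.node a u v)).edist (.inr (root v)) (.inl (root u)) = 1 :=
  SimpleGraph.edist_eq_one_iff_adj.2 (by simp)

/-- If the center `x` lay strictly beyond the leftmost child, that child would have eccentricity
below the radius. A vertex on the child's side is one further from the root than from the child; a
vertex on the root's side is further from `x` than from the child. -/
lemma eq_of_mem_center {x : Vert (.node a u v)}
    (hr : .inr (root v) ∈ (treeGraph (.node a u v)).center)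
    (hx : x ∈ (treeGraph (.node a u v)).center)
    (hlt : (treeGraph (.node a u v)).edist (.inl (root u)) x
      < (treeGraph (.node a u v)).edist (.inr (root v)) x) : x = .inl (root u) := by
  set G := treeGraph (.node a u v) with hG
  by_contra hne
  induction x using Vert.node_cases with
  | inr q =>
    have := le_edist_inl_inr (a := a) (root u) q
    rw [SimpleGraph.edist_self, zero_add, ← hG] at this
    exact absurd (hlt.trans_le (le_add_self.trans this)) (lt_irrefl _)
  | inl p =>
    obtain ⟨y, hy⟩ := G.exists_edist_eq_eccent_of_finite (.inl (root u))
    have hle : G.eccent (.inl (root u)) + 1 ≤ G.radius := by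
      rw [← hy]
      induction y using Vert.node_cases with
      | inl y =>
        have := le_edist_inr_inl (a := a) y (root v)
        rw [SimpleGraph.edist_self, zero_add, ← hG, add_comm] at this
        rw [← (G.mem_center_iff _).1 hr]
        exact this.trans SimpleGraph.edist_le_eccent
      | inr y =>
        rw [← (G.mem_center_iff _).1 hx]
        refine le_trans ?_ ((le_edist_inl_inr p y).trans SimpleGraph.edist_le_eccent)
        have h₁ : G.edist (.inl (root u)) (.inr y) ≤ 1 + G.edist (.inr (root v)) (.inr y) := by
          rw [← edist_inr_root_inl_root (a := a) (u := u) (v := v),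
            ← hG, G.edist_comm (u := Vert.inr (root v))]
          exact SimpleGraph.edist_triangle
        rw [add_comm]
        exact (add_le_add_right h₁ 1).trans (by
          rw [← add_assoc]
          gcongr
          exact one_le_edist hne)
    have hfin : G.eccent (.inl (root u)) ≠ ⊤ := hy ▸ edist_ne_top _ _ _
    exact absurd (ENat.add_one_le_iff hfin |>.1 (hle.trans SimpleGraph.radius_le_eccent))
      (lt_irrefl _)

/-- Two center vertices of a tree are adjacent. -/
theorem adj_of_mem_center {t : BinaryTree Unit} {c d : Vert t} (hc : c ∈ (treeGraph t).center)
    (hd : d ∈ (treeGraph t).center) (hne : c ≠ d) : (treeGraph t).Adj c d := by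
  obtain ⟨W, hW⟩ := ((connected_treeGraph t).preconnected c d).exists_walk_length_eq_edist
  cases W with
  | nil => exact absurd rfl hne
  | @cons _ m _ h W =>
    -- Rerooting at the first edge of a shortest path from `c` to `d` makes its second vertex the
    -- leftmost child, and this child is nearer to `d`.
    obtain ⟨u, v, -, φ, hφc, hφm⟩ := exists_rerooting h
    obtain ⟨x, rfl⟩ := φ.surjective d
    subst hφc hφm
    rw [mem_center_iso] at hc hd
    have := eq_of_mem_center hc hd (by
      rw [← edist_iso φ, ← edist_iso φ, ← hW]
      refine (SimpleGraph.Walk.edist_le W).trans_lt ?_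
      rw [SimpleGraph.Walk.length_cons]
      exact_mod_cast Nat.lt_succ_self _)
    rwa [this]

/-- `t` is rooted at a center vertex and, if there are two center vertices, its leftmost child is
the other one. -/
def TreeCenterRooted (t : BinaryTree Unit) : Prop :=
  root t ∈ (treeGraph t).center ∧
    ((treeGraph t).center.ncard = 2 → leftmostChild t ∈ (treeGraph t).center)

lemma exists_treeCenterRooted (t : BinaryTree Unit) : ∃ t', RotEq t t' ∧ TreeCenterRooted t' := by
  by_cases ht : t = .nil
  · subst ht
    exact ⟨_, .refl _, by simp [TreeCenterRooted, SimpleGraph.center_eq_univ_of_subsingleton]⟩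
  have : Nonempty (Vert t) := ⟨root t⟩
  have key : ∃ c d, (treeGraph t).Adj c d ∧ c ∈ (treeGraph t).center ∧
      ((treeGraph t).center.ncard = 2 → d ∈ (treeGraph t).center) := by
    by_cases h : (treeGraph t).center.ncard = 2
    · obtain ⟨c, d, hne, h'⟩ := Set.ncard_eq_two.1 h
      have hc : c ∈ (treeGraph t).center := by simp [h']
      have hd : d ∈ (treeGraph t).center := by simp [h']
      exact ⟨c, d, adj_of_mem_center hc hd hne, hc, fun _ => hd⟩
    · obtain ⟨c, hc⟩ := (treeGraph t).center_nonempty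
      obtain ⟨d, hd⟩ := exists_adj ht c
      exact ⟨c, d, hd, hc, fun h' => absurd h' h⟩
  obtain ⟨c, d, hcd, hc, hd⟩ := key
  obtain ⟨u, v, hr, φ, rfl, rfl⟩ := exists_rerooting hcd
  refine ⟨_, hr, (mem_center_iso φ _).1 hc, fun h => (mem_center_iso φ _).1 (hd ?_)⟩
  rwa [ncard_center_iso φ]

/-! ### Centers of double stars -/

lemma adj_treeStar_root {k : ℕ} {p : Vert (treeStar k)} (h : p ≠ root _) :
    (treeGraph (treeStar k)).Adj (root _) p := by
  induction k with
  | zero => exact absurd (Subsingleton.elim (α := Vert .nil) p _) h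
  | succ k ih =>
    refine Vert.node_cases (a := ()) (u := .nil) (v := treeStar k)
      (motive := fun p => p ≠ root _ → (treeGraph (.node () .nil (treeStar k))).Adj (root _) p)
      (fun p _ => ?_) (fun p hp => ?_) p h
    · exact adj_inr_inl.2 ⟨Subsingleton.elim p _, rfl⟩
    · exact adj_inr_inr.2 (ih fun h => hp (h ▸ rfl))

lemma exists_ne_treeStar_root {k : ℕ} (hk : 1 ≤ k) : ∃ p : Vert (treeStar k), p ≠ root _ := by
  have := deg_treeStar_root k
  by_contra! h
  have he : (treeGraph (treeStar k)).neighborSet (root _) = ∅ := by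
    ext p
    simp [h p]
  rw [deg, he, Set.ncard_empty] at this
  omega

lemma eccent_inr_root_le (i j : ℕ) :
    (treeGraph (.node a (treeStar i) (treeStar j))).eccent (.inr (root _)) ≤ 2 := by
  refine iSup_le fun q => ?_
  induction q using Vert.node_cases with
  | inl q =>
    refine (SimpleGraph.edist_triangle (v := .inl (root _))).trans ?_
    rw [edist_inr_root_inl_root, ← one_add_one_eq_two]
    refine add_le_add_right ?_ 1
    by_cases h : q = root _
    · simp [h]
    · exact (SimpleGraph.edist_eq_one_iff_adj.2 (adj_inl_inl.2 (adj_treeStar_root h))).le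
  | inr q =>
    by_cases h : q = root _
    · simp [h]
    · exact (SimpleGraph.edist_eq_one_iff_adj.2
        (adj_inr_inr.2 (adj_treeStar_root h))).le.trans (by norm_num)

lemma two_le_eccent_inr_root {i : ℕ} (j : ℕ) (hi : 1 ≤ i) :
    2 ≤ (treeGraph (.node a (treeStar i) (treeStar j))).eccent (.inr (root _)) := by
  obtain ⟨p, hp⟩ := exists_ne_treeStar_root hi
  refine le_trans ?_ ((le_edist_inr_inl (a := a) p (root _)).trans SimpleGraph.edist_le_eccent)
  rw [SimpleGraph.edist_self, zero_add, ← one_add_one_eq_two]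
  gcongr
  exact one_le_edist (by simpa using hp.symm)

lemma three_le_eccent_inr {i j : ℕ} (hi : 1 ≤ i) {q : Vert (treeStar j)} (hq : q ≠ root _) :
    3 ≤ (treeGraph (.node a (treeStar i) (treeStar j))).eccent (.inr q) := by
  obtain ⟨p, hp⟩ := exists_ne_treeStar_root hi
  refine le_trans ?_ ((le_edist_inr_inl (a := a) p q).trans SimpleGraph.edist_le_eccent)
  rw [show (3 : ℕ∞) = 1 + 1 + 1 by norm_num]
  gcongr
  · exact one_le_edist (by simpa using hq)
  · exact one_le_edist (by simpa using hp.symm)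

lemma isLeaf_doubleStar_inr {i j : ℕ} (hj : 1 ≤ j) (p : Vert (treeStar j)) :
    IsLeaf (treeGraph (.node a (treeStar i) (treeStar j))) (.inr p) ↔ p ≠ root _ := by
  by_cases h : p = root _
  · subst h
    rw [IsLeaf, deg_inr_root, deg_treeStar_root]
    simp; omega
  · rw [IsLeaf, deg_inr_of_ne h]
    exact iff_of_true (isLeaf_treeStar h) h

lemma eccent_doubleStar_inr {i j : ℕ} (hi : 1 ≤ i) (hj : 1 ≤ j) (p : Vert (treeStar j)) :
    2 ≤ (treeGraph (.node a (treeStar i) (treeStar j))).eccent (.inr p) ∧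
      ((treeGraph (.node a (treeStar i) (treeStar j))).eccent (.inr p) = 2 ↔
        ¬ IsLeaf (treeGraph (.node a (treeStar i) (treeStar j))) (.inr p)) := by
  rw [isLeaf_doubleStar_inr hj]
  by_cases h : p = root _
  · subst h
    exact ⟨two_le_eccent_inr_root j hi, by
      simpa using le_antisymm (eccent_inr_root_le i j) (two_le_eccent_inr_root j hi)⟩
  · have := three_le_eccent_inr (a := a) hi h
    refine ⟨le_trans (by norm_num) this, ?_⟩
    simp only [ne_eq, h, not_false_eq_true, not_true_eq_false, iff_false]
    intro h'
    rw [h'] at this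
    exact absurd this (by norm_num)

lemma eccent_doubleStar {i j : ℕ} (hi : 1 ≤ i) (hj : 1 ≤ j)
    (x : Vert (.node a (treeStar i) (treeStar j))) :
    2 ≤ (treeGraph (.node a (treeStar i) (treeStar j))).eccent x ∧
      ((treeGraph (.node a (treeStar i) (treeStar j))).eccent x = 2 ↔
        ¬ IsLeaf (treeGraph (.node a (treeStar i) (treeStar j))) x) := by
  induction x using Vert.node_cases with
  | inr p => exact eccent_doubleStar_inr hi hj p
  | inl p =>
    rw [← eccent_iso (swapIso _ _ _), ← isLeaf_iso (swapIso _ _ _)]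
    exact eccent_doubleStar_inr hj hi p

lemma center_doubleStar {i j : ℕ} (hi : 1 ≤ i) (hj : 1 ≤ j) :
    (treeGraph (.node a (treeStar i) (treeStar j))).center
      = {x | ¬ IsLeaf (treeGraph (.node a (treeStar i) (treeStar j))) x} := by
  have hr : (treeGraph (.node a (treeStar i) (treeStar j))).radius = 2 :=
    le_antisymm (SimpleGraph.radius_le_eccent.trans (eccent_inr_root_le i j))
      (le_iInf fun x => (eccent_doubleStar hi hj x).1)
  ext x
  rw [SimpleGraph.mem_center_iff, hr, (eccent_doubleStar hi hj x).2]
  rfl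

lemma ncard_not_isLeaf_doubleStar {i j : ℕ} (hi : 1 ≤ i) (hj : 1 ≤ j) :
    {x | ¬ IsLeaf (treeGraph (.node a (treeStar i) (treeStar j))) x}.ncard = 2 := by
  rw [Set.ncard_eq_two]
  refine ⟨.inl (root _), .inr (root _), by simp, ?_⟩
  ext x
  induction x using Vert.node_cases with
  | inr p => simp [isLeaf_doubleStar_inr hj]
  | inl p =>
    have := isLeaf_iso (swapIso a (treeStar i) (treeStar j)) (.inl p)
    rw [swapIso_inl, isLeaf_doubleStar_inr hi] at this
    simp [← this]

/-- A center-rooted tree isomorphic to a double star is a double star as a rooted tree. -/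
lemma eq_doubleStar_of_iso {t : BinaryTree Unit} {i j : ℕ} (hi : 1 ≤ i) (hj : 1 ≤ j)
    (φ : treeGraph (.node a (treeStar i) (treeStar j)) ≃g treeGraph t) (ht : TreeCenterRooted t) :
    (treeGraph t).center.ncard = 2 ∧ ∃ k l, 1 ≤ k ∧ 1 ≤ l ∧
      t = .node () (treeStar k) (treeStar l) := by
  have hc : (treeGraph t).center = {x | ¬ IsLeaf (treeGraph t) x} := by
    ext x
    obtain ⟨y, rfl⟩ := φ.surjective x
    rw [mem_center_iso, center_doubleStar hi hj]
    exact not_congr (isLeaf_iso φ y).symm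
  have h2 : (treeGraph t).center.ncard = 2 := by
    rw [ncard_center_iso φ, center_doubleStar hi hj, ncard_not_isLeaf_doubleStar hi hj]
  refine ⟨h2, ?_⟩
  obtain ⟨h₁, h₃⟩ := ht
  specialize h₃ h2
  cases t with
  | nil =>
    have := Set.ncard_le_one_of_subsingleton (treeGraph .nil).center
    omega
  | node b u v =>
    rw [root_node] at h₁
    rw [leftmostChild_node] at h₃
    have hpair : (treeGraph (.node b u v)).center = {.inl (root u), .inr (root v)} := by
      refine (Set.eq_of_subset_of_ncard_le ?_ ?_ (Set.toFinite _)).symm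
      · rintro x (rfl | rfl)
        exacts [h₃, h₁]
      · rw [h2, Set.ncard_pair (by simp)]
    -- The two centers are the only non-leaves, so either side of the edge joining them is a star
    -- around its own root.
    have hleaf : ∀ x : Vert (.node b u v), x ≠ .inl (root u) → x ≠ .inr (root v) →
        IsLeaf (treeGraph (.node b u v)) x := fun x hx hx' => by
      by_contra h
      have : x ∈ (treeGraph (.node b u v)).center := hc ▸ h
      rw [hpair] at this
      exact this.elim hx hx'
    have hu : u = treeStar u.numNodes := eq_treeStar fun p hp =>
      (deg_inl_of_ne hp).symm.trans (hleaf (.inl p) (by simpa using hp) (by simp))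
    have hv : v = treeStar v.numNodes := eq_treeStar fun p hp =>
      (deg_inr_of_ne hp).symm.trans (hleaf (.inr p) (by simp) (by simpa using hp))
    rw [hc] at h₁ h₃
    refine ⟨u.numNodes, v.numNodes, ?_, ?_, by rw [← hu, ← hv]⟩
    · refine Nat.pos_of_ne_zero fun h => h₃ ?_
      rw [IsLeaf, deg_inl_root, hu, h, deg_treeStar_root]
    · refine Nat.pos_of_ne_zero fun h => h₁ ?_
      rw [IsLeaf, deg_inr_root, hv, h, deg_treeStar_root]

end Center

/-! ### Thin leaves and bushes -/

/-- Rooting at the other neighbor of the degree-two vertex `b`, with `b` as leftmost child, leaves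
the thin leaf as the only child of `b`. -/
lemma exists_rotEq_thin {t : BinaryTree Unit} (h : ∃ p, IsThinLeaf (treeGraph t) p) :
    ∃ v, RotEq t (.node () (treeStar 1) v) := by
  obtain ⟨p, hp, b, hpb, hb⟩ := h
  obtain ⟨c, d, hcd, hset⟩ := Set.ncard_eq_two.1 hb
  obtain ⟨r, hr, hrp⟩ : ∃ r, (treeGraph t).Adj r b ∧ r ≠ p := by
    have hc : c ∈ (treeGraph t).neighborSet b := by simp [hset]
    have hd : d ∈ (treeGraph t).neighborSet b := by simp [hset]
    by_cases h : c = p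
    · exact ⟨d, hd.symm, fun h' => hcd (h.trans h'.symm)⟩
    · exact ⟨c, hc.symm, h⟩
  obtain ⟨u, v, hrot, φ, rfl, rfl⟩ := exists_rerooting hr
  obtain ⟨x, rfl⟩ := φ.surjective p
  rw [φ.map_adj_iff] at hpb
  rw [isLeaf_iso] at hp
  rw [deg_iso] at hb
  refine ⟨v, ?_⟩
  suffices u = treeStar 1 by rwa [← this]
  rw [deg_inl_root] at hb
  induction x using Vert.node_cases with
  | inr x =>
    obtain ⟨-, rfl⟩ := adj_inr_inl.1 hpb
    exact absurd rfl hrp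
  | inl x =>
    rw [adj_inl_inl] at hpb
    cases u with
    | nil => exact absurd hpb (not_adj_nil _ _)
    | node a u₁ u₂ =>
      rw [root_node, deg_inr_root] at hb
      have hu₂ : u₂ = .nil := deg_root_eq_zero.1 (by omega)
      subst hu₂
      induction x using Vert.node_cases with
      | inr x => exact absurd (adj_inr_inr.1 hpb) (not_adj_nil _ _)
      | inl x =>
        obtain ⟨rfl, -⟩ := adj_inl_inr.1 hpb
        rw [IsLeaf, deg_inl_of_ne (by simp), deg_inl_root, Nat.add_eq_right] at hp
        rw [deg_root_eq_zero.1 hp]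
        rfl

lemma exists_isThinLeaf_node (v : BinaryTree Unit) :
    ∃ p, IsThinLeaf (treeGraph (.node () (treeStar 1) v)) p := by
  refine ⟨flipLeaf .nil v, isLeaf_flipLeaf, .inl (.inr (root .nil)),
    adj_inl_inl.2 (adj_inl_inr.2 ⟨rfl, rfl⟩), ?_⟩
  exact deg_flipSrc_left.trans (by simp)

/-- Unless `t` is a star rooted at its center, some non-root internal vertex has only leaves as
children. The recursion descends to such a vertex, collecting the rest of the tree in the context
`w`. -/
lemma exists_rotEq_node_treeStar (t w : BinaryTree Unit) :
    t = treeStar t.numNodes ∨ ∃ k v, 1 ≤ k ∧ RotEq (append t w) (.node () (treeStar k) v) := by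
  induction t generalizing w with
  | nil => exact .inl rfl
  | node a u v ihu ihv =>
    rcases ihu (.node () (append v w) .nil) with hu | ⟨k, z, hk, h⟩
    · rcases Nat.eq_zero_or_pos u.numNodes with h0 | hpos
      · rw [h0] at hu
        rcases ihv (append w (.node () u .nil)) with hv | ⟨k, z, hk, h⟩
        · refine .inl ?_
          rw [numNodes, h0, Nat.zero_add, treeStar, ← hv, hu]
          rfl
        · exact .inr ⟨k, z, hk, (RotEq.cycle a u (append v w)).trans (by rwa [append_assoc])⟩
      · refine .inr ⟨_, append v w, hpos, ?_⟩
        rw [← hu]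
        exact .refl _
    · exact .inr ⟨k, z, hk, ((RotEq.swap a u (append v w)).trans (RotEq.cycle _ _ _)).trans h⟩

lemma exists_rotEq_bush {t : BinaryTree Unit} (hs : ¬ IsStar (treeGraph t))
    (ht : ¬ ∃ p, IsThinLeaf (treeGraph t) p) :
    ∃ k v, 2 ≤ k ∧ RotEq t (.node () (treeStar k) v) := by
  rcases exists_rotEq_node_treeStar t .nil with h | ⟨k, v, hk, h⟩
  · exact absurd (h ▸ isStar_treeStar _) hs
  · rw [append_nil] at h
    refine ⟨k, v, ?_, h⟩
    rcases hk.eq_or_lt with rfl | hk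
    · obtain ⟨φ⟩ := h.nonempty_iso
      exact absurd ((exists_isThinLeaf_iso φ).1 (exists_isThinLeaf_node v)) ht
    · exact hk

/-! ### From words to trees -/

open DyckWord (ofTree ofTree_toTree toTree_ofTree)

lemma toTree_injective : Function.Injective DyckWord.toTree := DyckWord.equivTree.injective

@[simp] lemma toTree_zero : (0 : DyckWord).toTree = .nil := toTree_ofTree .nil

@[simp] lemma toTree_nest_add (x y : DyckWord) :
    (x.nest + y).toTree = .node () x.toTree y.toTree := by
  rw [← toTree_ofTree (.node () x.toTree y.toTree), ofTree, ofTree_toTree, ofTree_toTree]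

@[simp] lemma toTree_nest (x : DyckWord) : x.nest.toTree = .node () x.toTree .nil := by
  rw [← add_zero x.nest, toTree_nest_add, toTree_zero]

lemma ofTree_append (s t : BinaryTree Unit) : ofTree (append s t) = ofTree s + ofTree t := by
  induction s with
  | nil => exact (zero_add _).symm
  | node a u v _ ih => rw [node_append, ofTree, ofTree, ih, add_assoc]

lemma toTree_add (x y : DyckWord) : (x + y).toTree = append x.toTree y.toTree := by
  rw [← toTree_ofTree (append _ _), ofTree_append, ofTree_toTree, ofTree_toTree]

lemma toTree_rot (x : DyckWord) : (rot x).toTree = treeRot x.toTree := by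
  by_cases h : x = 0
  · simp [rot, h, treeRot]
  · conv_rhs => rw [← DyckWord.nest_insidePart_add_outsidePart h]
    rw [rot, if_neg h, toTree_nest_add, treeRot, toTree_add, toTree_nest]

lemma toTree_rot_iterate (r : ℕ) (x : DyckWord) :
    (rot^[r] x).toTree = treeRot^[r] x.toTree :=
  (Function.Semiconj.iterate_right toTree_rot r) x

lemma toTree_zigzag (k : ℕ) : (zigzag k).toTree = treeStar k := by
  induction k with
  | zero => exact (congrArg _ (zero_nsmul _)).trans toTree_zero
  | succ k ih =>
    rw [zigzag, succ_nsmul', toTree_nest_add, toTree_zero, treeStar, ← ih, zigzag]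

lemma mem_rotations_iff {x z : DyckWord} : z ∈ rotations x ↔ RotEq x.toTree z.toTree :=
  exists_congr fun r => by rw [← toTree_rot_iterate, toTree_injective.eq_iff, eq_comm]

lemma rotations_eq {x z : DyckWord} (h : z ∈ rotations x) : rotations z = rotations x := by
  rw [mem_rotations_iff] at h
  ext y
  rw [mem_rotations_iff, mem_rotations_iff]
  exact ⟨h.trans, h.symm.trans⟩

lemma semilength_eq {x z : DyckWord} (h : z ∈ rotations x) : z.semilength = x.semilength := by
  rw [← DyckWord.numNodes_toTree, (mem_rotations_iff.1 h).numNodes_eq, DyckWord.numNodes_toTree]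

lemma hasThinForm_iff {x : DyckWord} :
    HasThinForm x ↔ ∃ v, x.toTree = .node () (treeStar 1) v := by
  constructor
  · rintro ⟨v, rfl⟩
    exact ⟨v.toTree, by rw [toTree_nest_add, toTree_zigzag]⟩
  · rintro ⟨v, hv⟩
    refine ⟨ofTree v, toTree_injective ?_⟩
    rw [hv, toTree_nest_add, toTree_zigzag, toTree_ofTree]

lemma hasBushForm_iff {x : DyckWord} :
    HasBushForm x ↔ ∃ k v, 2 ≤ k ∧ x.toTree = .node () (treeStar k) v := by
  constructor
  · rintro ⟨k, v, hk, rfl⟩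
    exact ⟨k, v.toTree, hk, by rw [toTree_nest_add, toTree_zigzag]⟩
  · rintro ⟨k, v, hk, hv⟩
    refine ⟨k, ofTree v, hk, toTree_injective ?_⟩
    rw [hv, toTree_nest_add, toTree_zigzag, toTree_ofTree]

lemma flippablePair_iff {x y : DyckWord} :
    FlippablePair x y ↔ ∃ w v, x.toTree = flipSrc w v ∧ y.toTree = flipTgt w v := by
  constructor
  · rintro ⟨w, v, rfl, rfl⟩
    refine ⟨w.toTree, v.toTree, by simp, ?_⟩
    rw [add_assoc, toTree_nest_add, toTree_nest_add, toTree_zero]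
  · rintro ⟨w, v, hx, hy⟩
    refine ⟨ofTree w, ofTree v, toTree_injective ?_, toTree_injective ?_⟩
    · simp [hx, toTree_ofTree]
    · rw [hy, add_assoc, toTree_nest_add, toTree_nest_add, toTree_zero, toTree_ofTree,
        toTree_ofTree]

/-! ### Canonical rootings -/

/-- The choice is made from a predicate that depends only on the set of rotations, so equal classes
yield the same chosen word even without uniqueness of the minimizer. -/
lemma canonicalRoot_eq {x z : DyckWord} (h : z ∈ rotations x) :
    canonicalRoot z = canonicalRoot x := by
  have : IsCanonicalRooting z = IsCanonicalRooting x := by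
    funext y
    rw [IsCanonicalRooting, rotations_eq h]
    rfl
  rw [canonicalRoot, this, canonicalRoot]

lemma finite_rotations (x : DyckWord) : (rotations x).Finite := by
  have : rotations x ⊆
      Set.range (Subtype.val : {y : DyckWord // y.semilength = x.semilength} → DyckWord) := by
    intro z hz
    exact ⟨⟨z, semilength_eq hz⟩, rfl⟩
  exact (Set.finite_range _).subset this

lemma isCanonicalRooting_canonicalRoot (x : DyckWord) :
    IsCanonicalRooting x (canonicalRoot x) := by
  refine Classical.epsilon_spec (p := IsCanonicalRooting x) ?_
  have hfin : {z | z ∈ rotations x ∧ CenterRooted z}.Finite :=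
    (finite_rotations x).subset fun z hz => hz.1
  obtain ⟨t, ht, hc⟩ := exists_treeCenterRooted x.toTree
  have hne : {z | z ∈ rotations x ∧ CenterRooted z}.Nonempty := by
    rw [← toTree_ofTree t] at ht hc
    exact ⟨ofTree t, mem_rotations_iff.2 ht, hc⟩
  obtain ⟨z, hz, hmin⟩ := Set.exists_min_image _ rootingKey hfin hne
  exact ⟨z, hz, fun z' h h' => hmin z' ⟨h, h'⟩⟩

lemma RotatedUntil.unique {P : DyckWord → Prop} {z x y : DyckWord} (hx : RotatedUntil P z x)
    (hy : RotatedUntil P z y) : x = y := by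
  obtain ⟨r, rfl, hr, hr'⟩ := hx
  obtain ⟨s, rfl, hs, hs'⟩ := hy
  rcases lt_trichotomy r s with h | rfl | h
  · exact absurd hr (hs' r h)
  · rfl
  · exact absurd hs (hr' s h)

lemma RotatedUntil.eq_of_prop {P : DyckWord → Prop} {z x : DyckWord} (hx : RotatedUntil P z x)
    (h : P z) : x = z :=
  hx.unique ⟨0, rfl, h, fun s hs => absurd hs (Nat.not_lt_zero s)⟩

lemma RotatedUntil.mem_rotations {P : DyckWord → Prop} {z x : DyckWord}
    (hx : RotatedUntil P z x) : x ∈ rotations z := by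
  obtain ⟨r, rfl, -⟩ := hx
  exact ⟨r, rfl⟩

lemma RotatedUntil.prop {P : DyckWord → Prop} {z x : DyckWord} (hx : RotatedUntil P z x) :
    P x := by
  obtain ⟨r, rfl, h, -⟩ := hx
  exact h

lemma exists_rotatedUntil {P : DyckWord → Prop} {z y : DyckWord} (hy : y ∈ rotations z)
    (h : P y) : ∃ x, RotatedUntil P z x := by
  classical
  obtain ⟨r, rfl⟩ := hy
  have hex : ∃ r, P (rot^[r] z) := ⟨r, h⟩
  exact ⟨_, Nat.find hex, rfl, Nat.find_spec hex, fun s => Nat.find_min hex⟩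

/-! ### Lexicographic comparison of double stars -/

lemma bits_add (x y : DyckWord) : bits (x + y) = bits x ++ bits y := List.map_append

lemma bits_nest (x : DyckWord) : bits x.nest = 1 :: (bits x ++ [0]) := by
  simp [bits, DyckWord.nest]

/-- After the common prefix `1(10)^j` the first word continues with `0` and the second with `1`. -/
lemma bits_doubleStar_lt (j d : ℕ) (x y : DyckWord) :
    bits ((zigzag j).nest + x) < bits ((zigzag (j + (d + 1))).nest + y) := by
  have h : zigzag (j + (d + 1)) = zigzag j + (DyckWord.nest 0 + zigzag d) := by
    rw [zigzag, add_nsmul, succ_nsmul']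
    rfl
  rw [h]
  simp only [bits_add, bits_nest, List.append_assoc, List.cons_append]
  refine List.cons_lt_cons_iff.2 (.inr ⟨rfl, ?_⟩)
  refine List.Lex.append_left _ ?_ _
  exact .rel (by norm_num)

lemma le_of_bits_le {i j : ℕ} {x y : DyckWord}
    (h : bits ((zigzag i).nest + x) ≤ bits ((zigzag j).nest + y)) : i ≤ j := by
  by_contra! hlt
  obtain ⟨d, rfl⟩ := Nat.exists_eq_add_of_lt hlt
  exact absurd (bits_doubleStar_lt j d y x) (not_lt.2 h)

/-! ### Flip edges -/

lemma isStar_node_treeStar_nil (k : ℕ) : IsStar (treeGraph (.node () (treeStar k) .nil)) :=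
  isStar_of_iso (swapIso () .nil (treeStar k)) (isStar_treeStar (k + 1))

lemma FlippablePair.unique {x y z : DyckWord} (hy : FlippablePair x y) (hz : FlippablePair x z) :
    y = z := by
  obtain ⟨w, v, hx, hy⟩ := flippablePair_iff.1 hy
  obtain ⟨w', v', hx', hz⟩ := flippablePair_iff.1 hz
  have h := hx.symm.trans hx'
  simp only [node.injEq, true_and] at h
  obtain ⟨rfl, rfl⟩ := h
  exact toTree_injective (hy.trans hz.symm)

theorem IsFlipTree.signature_lt {x y : DyckWord} (hx : IsFlipTree x) (h : FlippablePair x y) :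
    signature x < signature y := by
  obtain ⟨w, v, hxt, hyt⟩ := flippablePair_iff.1 h
  obtain ⟨hs, hx⟩ := hx
  rw [signature, signature, graph, graph, hxt, hyt]
  rw [graph, hxt] at hs
  -- With `v` empty the root would be a leaf hanging on the center of a star.
  have hv : ∀ k, .node () .nil w = treeStar k → v ≠ .nil := by
    rintro k hk rfl
    refine hs ?_
    rw [flipSrc, hk]
    exact isStar_node_treeStar_nil k
  rcases hx with ⟨-, hP⟩ | ⟨-, hP, hl⟩
  · obtain ⟨v', h⟩ := hasThinForm_iff.1 hP.prop
    simp only [hxt, treeStar, node.injEq, true_and] at h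
    obtain ⟨rfl, rfl⟩ := h
    exact signature_lt_of_thin (hv 1 rfl)
  · obtain ⟨k, v', hk, h⟩ := hasBushForm_iff.1 hP.prop
    -- The bush has `k = j + 1` leaves: the one that moves and the `j` that stay.
    obtain ⟨j, rfl⟩ := Nat.exists_eq_add_of_le' (show 1 ≤ k by omega)
    simp only [hxt, treeStar, node.injEq, true_and] at h
    obtain ⟨rfl, rfl⟩ := h
    refine signature_lt_of_bush (by omega) (hv (j + 1) rfl) ?_
    rintro l rfl
    refine hl (j + 1) l hk (toTree_injective ?_)
    rw [hxt, toTree_nest_add, toTree_zigzag, toTree_zigzag, treeStar]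

/-- Both words start from the same canonical rooting and, thin leaves being an invariant of the
class, search for the same form; the first hit is unique. -/
lemma IsFlipTree.eq {x y : DyckWord} (hx : IsFlipTree x) (hy : IsFlipTree y)
    (h : y ∈ rotations x) : x = y := by
  obtain ⟨-, hx⟩ := hx
  obtain ⟨-, hy⟩ := hy
  obtain ⟨φ⟩ := (mem_rotations_iff.1 h).nonempty_iso
  have hφ := exists_isThinLeaf_iso φ
  rw [canonicalRoot_eq h] at hy
  rcases hx with ⟨hx, hx'⟩ | ⟨hx, hx', -⟩ <;> rcases hy with ⟨hy, hy'⟩ | ⟨hy, hy', -⟩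
  · exact hx'.unique hy'
  · exact absurd (hφ.2 hx) hy
  · exact absurd (hφ.1 hy) hx
  · exact hx'.unique hy'

/-- The minimality of the canonical rooting of a double star. -/
lemma le_of_canonicalRoot_eq {x : DyckWord} {k l : ℕ}
    (h : canonicalRoot x = (zigzag k).nest + zigzag l)
    (h2 : HasTwoCenters ((zigzag k).nest + zigzag l)) : k ≤ l := by
  have hc := isCanonicalRooting_canonicalRoot x
  rw [h] at hc
  obtain ⟨⟨hr, h₁, h₃⟩, hmin⟩ := hc
  set c := (zigzag k).nest + zigzag l with hcdef
  -- Exchanging the two centers gives another center-rooted rotation, with which the canonical one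
  -- is compared.
  set d := (zigzag l).nest + zigzag k with hddef
  have hct : c.toTree = .node () (zigzag k).toTree (zigzag l).toTree := toTree_nest_add _ _
  have hdt : d.toTree = .node () (zigzag l).toTree (zigzag k).toTree := toTree_nest_add _ _
  specialize h₃ h2
  rw [HasTwoCenters, graph, hct] at h2
  rw [graph, hct] at h₁ h₃
  have h2d : HasTwoCenters d := by
    rw [HasTwoCenters, graph, hdt, ncard_center_iso (swapIso _ _ _), h2]
  have hmem : d ∈ rotations x := by
    rw [← rotations_eq hr, mem_rotations_iff, hct, hdt]
    exact .swap _ _ _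
  have hcr : CenterRooted d := by
    rw [CenterRooted, graph, hdt]
    exact ⟨(mem_center_iso (swapIso _ _ _) _).2 h₃, fun _ =>
      (mem_center_iso (swapIso _ _ _) _).2 h₁⟩
  have := hmin d hmem hcr
  rw [rootingKey, if_pos, rootingKey, if_pos h2d] at this
  · exact le_of_bits_le this
  · rw [HasTwoCenters, graph, hct, h2]

theorem exists_isFlipTree {x : DyckWord} (hs : ¬ IsStar (graph x)) :
    ∃ z y, z ∈ rotations x ∧ y.semilength = z.semilength ∧ FlippablePair z y ∧ IsFlipTree z := by
  have hc := isCanonicalRooting_canonicalRoot x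
  obtain ⟨⟨hr, hcr⟩, -⟩ := hc
  have hmem : ∀ {P z}, RotatedUntil P (canonicalRoot x) z → z ∈ rotations x := fun hz => by
    rw [← rotations_eq hr]
    exact hz.mem_rotations
  have hstar : ∀ {z}, z ∈ rotations x → ¬ IsStar (graph z) := fun hz => by
    obtain ⟨φ⟩ := (mem_rotations_iff.1 hz).nonempty_iso
    exact fun h => hs ((isStar_iso φ).1 h)
  have hthin : ∀ {z}, z ∈ rotations x →
      ((∃ a, IsThinLeaf (graph z) a) ↔ ∃ a, IsThinLeaf (graph x) a) := fun hz => by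
    obtain ⟨φ⟩ := (mem_rotations_iff.1 hz).nonempty_iso
    exact exists_isThinLeaf_iso φ
  have hcanon := mem_rotations_iff.1 hr
  by_cases ht : ∃ a, IsThinLeaf (graph x) a
  · obtain ⟨v, hv⟩ := exists_rotEq_thin ht
    have hv' := hcanon.symm.trans hv
    rw [← toTree_ofTree (.node () (treeStar 1) v)] at hv'
    obtain ⟨z, hz⟩ := exists_rotatedUntil (P := HasThinForm) (mem_rotations_iff.2 hv')
      (hasThinForm_iff.2 ⟨v, toTree_ofTree _⟩)
    have hzr := hmem hz
    obtain ⟨v', hv'⟩ := hasThinForm_iff.1 hz.prop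
    refine ⟨z, ofTree (flipTgt .nil v'), hzr, ?_,
      flippablePair_iff.2 ⟨.nil, v', hv', toTree_ofTree _⟩,
      hstar hzr, .inl ⟨(hthin hzr).2 ht, by rwa [canonicalRoot_eq hzr]⟩⟩
    rw [← DyckWord.numNodes_toTree, ← DyckWord.numNodes_toTree, hv', toTree_ofTree]
    simp [treeStar]
    omega
  · obtain ⟨k, v, hk, hv⟩ := exists_rotEq_bush hs ht
    have hv' := hcanon.symm.trans hv
    rw [← toTree_ofTree (.node () (treeStar k) v)] at hv'
    obtain ⟨z, hz⟩ := exists_rotatedUntil (P := HasBushForm) (mem_rotations_iff.2 hv')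
      (hasBushForm_iff.2 ⟨k, v, hk, toTree_ofTree _⟩)
    have hzr := hmem hz
    obtain ⟨k', v', hk', hv'⟩ := hasBushForm_iff.1 hz.prop
    obtain ⟨k', rfl⟩ := Nat.exists_eq_add_of_le' (show 1 ≤ k' by omega)
    refine ⟨z, ofTree (flipTgt (treeStar k') v'), hzr, ?_,
      flippablePair_iff.2 ⟨treeStar k', v', hv', toTree_ofTree _⟩, hstar hzr,
      .inr ⟨mt (hthin hzr).1 ht, by rwa [canonicalRoot_eq hzr], fun i j hi hij => ?_⟩⟩
    · rw [← DyckWord.numNodes_toTree, ← DyckWord.numNodes_toTree, hv', toTree_ofTree]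
      simp
      omega
    · have hzt : z.toTree = .node () (treeStar i) (treeStar j) := by
        rw [hij, toTree_nest_add, toTree_zigzag, toTree_zigzag]
      have hj : 1 ≤ j := by
        refine Nat.pos_of_ne_zero fun h => hstar hzr ?_
        rw [graph, hzt, h]
        exact isStar_node_treeStar_nil i
      have hzc : RotEq z.toTree (canonicalRoot x).toTree :=
        (mem_rotations_iff.1 hzr).symm.trans hcanon
      rw [hzt] at hzc
      obtain ⟨φ⟩ := hzc.nonempty_iso
      -- The tree is a double star, so its canonical rooting is one as a rooted tree. Since `p = 1`
      -- would create a thin leaf, that rooting already has bush form and the search stops at once.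
      obtain ⟨h2, p, q, hp, hq, hpq⟩ := eq_doubleStar_of_iso (by omega) hj φ hcr
      have hp2 : 2 ≤ p := by
        rcases hp.eq_or_lt with rfl | hp
        · refine absurd ((hthin hr).1 ?_) ht
          rw [graph, hpq]
          exact exists_isThinLeaf_node _
        · exact hp
      have hzeq : z = canonicalRoot x := hz.eq_of_prop (hasBushForm_iff.2 ⟨p, _, hp2, hpq⟩)
      rw [← hzeq, hij] at h2
      exact le_of_canonicalRoot_eq (hzeq.symm.trans hij) h2

/-! ### The graph of plane trees -/

lemma toPlane_eq_iff {n : ℕ} {x y : RootedTree n} :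
    toPlane x = toPlane y ↔ y.1 ∈ rotations x.1 := by
  constructor
  -- The set of rotations is constant on classes and therefore descends to the quotient.
  · have hinv : ∀ x y : RootedTree n, y.1 = rot x.1 → rotations x.1 = rotations y.1 :=
      fun x y h => (rotations_eq ⟨1, h⟩).symm
    intro h
    have := congrArg (Quot.lift (fun x : RootedTree n => rotations x.1) hinv) h
    change rotations x.1 = rotations y.1 at this
    rw [this]
    exact ⟨0, rfl⟩
  · rintro ⟨r, hr⟩
    induction r generalizing y with
    | zero => exact congrArg toPlane (Subtype.ext hr.symm)
    | succ r ih =>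
      rw [Function.iterate_succ_apply'] at hr
      have hlen : (rot^[r] x.1).semilength = n := (semilength_eq ⟨r, rfl⟩).trans x.2
      exact (ih (y := ⟨_, hlen⟩) rfl).trans (Quot.sound hr)

lemma signature_eq {x z : DyckWord} (h : z ∈ rotations x) : signature z = signature x := by
  obtain ⟨φ⟩ := (mem_rotations_iff.1 h).nonempty_iso
  exact graphSignature_iso φ

/-- The signature of a plane tree. -/
noncomputable def planeSignature {n : ℕ} : PlaneTree n → ℕ ×ₗ ℕ ×ₗ ℕ :=
  Quot.lift (fun x => signature x.1) fun _ _ h => (signature_eq ⟨1, h⟩).symm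

lemma FlipEdge.planeSignature_lt {n : ℕ} (e : FlipEdge n) :
    planeSignature e.src < planeSignature e.tgt :=
  e.2.2.signature_lt e.2.1

lemma FlipEdge.src_injective {n : ℕ} : Function.Injective (FlipEdge.src (n := n)) := by
  rintro ⟨⟨x, y⟩, h, hx⟩ ⟨⟨x', y'⟩, h', hx'⟩ he
  have := Subtype.ext (hx.eq hx' (toPlane_eq_iff.1 he))
  dsimp only at this
  subst this
  have := Subtype.ext (h.unique h')
  dsimp only at this
  subst this
  rfl

/-- Following arcs to the sink gives connectedness. Each node other than the sink contributes
exactly one edge, so there is one edge fewer than there are nodes. -/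
lemma isTree_fromRel {V α : Type*} [Finite V] [Preorder α] {R : V → V → Prop} (f : V → α) {S : V}
    (huniq : ∀ {a b c}, R a b → R a c → b = c) (hlt : ∀ {a b}, R a b → f a < f b)
    (hS : ∀ a, (∃ b, R a b) ↔ a ≠ S) (hreach : ∀ a, Relation.ReflTransGen R a S) :
    (SimpleGraph.fromRel R).IsTree := by
  have hne : ∀ {a b}, R a b → a ≠ b := fun h h' => lt_irrefl _ (h' ▸ hlt h)
  rw [SimpleGraph.isTree_iff_connected_and_card]
  constructor
  · have hS' : ∀ a, (SimpleGraph.fromRel R).Reachable a S := fun a => by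
      induction hreach a using Relation.ReflTransGen.head_induction_on with
      | refl => exact .rfl
      | head h _ ih =>
        exact (SimpleGraph.Adj.reachable ((SimpleGraph.fromRel_adj _ _ _).2
          ⟨hne h, .inl h⟩)).trans ih
    have : Nonempty V := ⟨S⟩
    exact ⟨fun a b => (hS' a).trans (hS' b).symm⟩
  · choose g hg using fun a : {a // a ≠ S} => (hS a.1).2 a.2
    let F : {a // a ≠ S} → (SimpleGraph.fromRel R).edgeSet := fun a =>
      ⟨s(a.1, g a), (SimpleGraph.fromRel_adj _ _ _).2 ⟨hne (hg a), .inl (hg a)⟩⟩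
    have hF : Function.Bijective F := by
      constructor
      · intro a b hab
        have h := congrArg Subtype.val hab
        rcases Sym2.eq_iff.1 h with ⟨h, -⟩ | ⟨h, h'⟩
        -- In the remaining case the edge would be an arc in both directions, and `f` would increase
        -- along each.
        · exact Subtype.ext h
        · have h₁ := hlt (hg a)
          have h₂ := hlt (hg b)
          rw [h'] at h₁
          rw [← h] at h₂
          exact absurd h₁ h₂.asymm
      · rintro ⟨e, he⟩
        induction e using Sym2.ind with
        | _ a b =>
          obtain ⟨-, h | h⟩ := (SimpleGraph.fromRel_adj _ _ _).1 he
          · change R a b at h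
            have ha := (hS a).1 ⟨b, h⟩
            exact ⟨⟨a, ha⟩, Subtype.ext (congrArg (fun x => s(a, x)) (huniq (hg ⟨a, ha⟩) h))⟩
          · change R b a at h
            have hb := (hS b).1 ⟨a, h⟩
            exact ⟨⟨b, hb⟩, Subtype.ext
              ((congrArg (fun x => s(b, x)) (huniq (hg ⟨b, hb⟩) h)).trans Sym2.eq_swap)⟩
    rw [← Nat.card_congr (Equiv.ofBijective F hF)]
    have h := Set.ncard_add_ncard_compl ({S} : Set V)
    rw [Set.ncard_singleton, add_comm] at h
    exact h

end FlipTree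


/-- The directed graph `𝒯ₙ` is a spanning tree on the plane trees with `n` edges: it has no loops,
no two of its edges join the same two nodes, and the graph obtained by forgetting orientations is
a tree. Moreover, each node has out-degree at most one, the signature strictly increases along
every edge, and the node of the star is the unique node without outgoing edge and is reached from
every node. -/
theorem mainTheorem2 (n : ℕ) (hn : 1 ≤ n) :
    ((∀ e : FlipEdge n, e.src ≠ e.tgt) ∧
      (∀ e e' : FlipEdge n, s(e.src, e.tgt) = s(e'.src, e'.tgt) → e = e') ∧
      (underlyingGraph n).IsTree) ∧
    (∀ e e' : FlipEdge n, e.src = e'.src → e = e') ∧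
    (∀ x y : RootedTree n, Arc (toPlane x) (toPlane y) → signature x.1 < signature y.1) ∧
    (∃ S : PlaneTree n, (∀ x : RootedTree n, toPlane x = S ↔ IsStar (graph x.1)) ∧
      (∀ T : PlaneTree n, (∃ e : FlipEdge n, e.src = T) ↔ T ≠ S) ∧
      (∀ T : PlaneTree n, Relation.ReflTransGen Arc T S)) := by
  have hlt : ∀ {S T : PlaneTree n}, Arc S T → planeSignature S < planeSignature T := by
    rintro _ _ ⟨e, rfl, rfl⟩
    exact e.planeSignature_lt
  have hne : ∀ e : FlipEdge n, e.src ≠ e.tgt := fun e h =>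
    lt_irrefl _ (h ▸ e.planeSignature_lt)
  have huniq : ∀ {S T T' : PlaneTree n}, Arc S T → Arc S T' → T = T' := by
    rintro _ _ _ ⟨e, rfl, rfl⟩ ⟨e', h, rfl⟩
    rw [FlipEdge.src_injective h]
  let star : RootedTree n := ⟨zigzag n, by
    rw [← DyckWord.numNodes_toTree, toTree_zigzag, numNodes_treeStar]⟩
  have hstar : ∀ x : RootedTree n, toPlane x = toPlane star ↔ IsStar (graph x.1) := by
    intro x
    rw [toPlane_eq_iff, mem_rotations_iff, toTree_zigzag]
    constructor
    · intro h
      obtain ⟨φ⟩ := h.nonempty_iso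
      exact (isStar_iso φ).1 (isStar_treeStar n)
    · intro h
      have := rotEq_treeStar h
      rwa [DyckWord.numNodes_toTree, x.2] at this
  have hout : ∀ T : PlaneTree n, (∃ e : FlipEdge n, e.src = T) ↔ T ≠ toPlane star := by
    intro T
    constructor
    · rintro ⟨e, rfl⟩ h
      exact e.2.2.1 ((hstar _).1 h)
    · induction T using Quot.ind with
      | _ x =>
        intro h
        obtain ⟨z, y, hz, hy, hzy, hflip⟩ := exists_isFlipTree (mt (hstar x).2 h)
        have hzn : z.semilength = n := (semilength_eq hz).trans x.2
        refine ⟨⟨⟨⟨z, hzn⟩, ⟨y, hy.trans hzn⟩⟩, hzy, hflip⟩, ?_⟩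
        exact (toPlane_eq_iff.2 hz).symm
  have hout' : ∀ T : PlaneTree n, (∃ T', Arc T T') ↔ T ≠ toPlane star := fun T => by
    rw [← hout]
    exact ⟨fun ⟨_, e, he, _⟩ => ⟨e, he⟩, fun ⟨e, he⟩ => ⟨_, e, he, rfl⟩⟩
  have : Finite (PlaneTree n) := inferInstanceAs (Finite (Quot _))
  have hreach : ∀ T : PlaneTree n, Relation.ReflTransGen Arc T (toPlane star) := by
    -- There are finitely many plane trees, so the signature cannot increase forever along a path.
    have hwf : WellFounded fun S T : PlaneTree n => planeSignature T < planeSignature S :=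
      @Finite.wellFounded_of_trans_of_irrefl _ _ _ ⟨fun _ _ _ h h' => h'.trans h⟩
        ⟨fun _ => lt_irrefl _⟩
    intro T
    induction T using hwf.induction with
    | _ T ih =>
      by_cases h : T = toPlane star
      · exact h ▸ .refl
      · obtain ⟨T', hT⟩ := (hout' T).2 h
        exact .head hT (ih T' (hlt hT))
  refine ⟨⟨hne, fun e e' h => ?_, isTree_fromRel planeSignature huniq hlt hout' hreach⟩,
    fun e e' h => FlipEdge.src_injective h, fun x y h => hlt h, toPlane star, hstar, hout, hreach⟩
  -- Two arcs on the same pair of nodes either share their source or are antiparallel; the latter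
  -- contradicts the increase of the signature.
  rcases Sym2.eq_iff.1 h with ⟨h, -⟩ | ⟨h, h'⟩
  · exact FlipEdge.src_injective h
  · have h₁ := e.planeSignature_lt
    have h₂ := e'.planeSignature_lt
    rw [h, h'] at h₁
    exact absurd h₁ h₂.asymm
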